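/- **Setting.** Let $\nu$ be a $\sigma$-finite measure on a Polish space $\mathscr V$ and let $N$ be a Poisson random measure on $\mathscr V$ with mean intensity $\nu$. For measurable $g\ge 0$ write $N(g)=\int g\,dN$ and $\Lambda(g)=\int_{\mathscr V}(1-e^{-g(x)})\,\nu(dx)$. Let $\mu,\beta\in\mathbb R$, $\Delta,\tilde\Delta>0$, and let $f_1,\dots,f_n,\tilde f\ge 0$ be measurable with $\Lambda(f_i)<\infty$, $\Lambda(\tilde f)<\infty$ and such that $\tau_i=N(f_i)$ and $\tilde\tau=N(\tilde f)$ are almost surely strictly positive. Let $\epsilon_1,\dots,\epsilon_n,\tilde\epsilon$ be independent standard normal variables, independent of $N$, and put $$X_i=\mu\Delta+\tau_i\beta+\tau_i^{1/2}\epsilon_i\quad(i=1,\dots,n),\qquad \tilde X=\mu\tilde\Delta+\tilde\tau\beta+\tilde\tau^{1/2}\tilde\epsilon .$$ Write $\mathbf X=(X_1,\dots,X_n)$, $A_i=X_i-\mu\Delta$, $\bar A=n^{-1}\sum_i A_i$, $\Omega_n(v)=\sum_{i=1}^n(y_i^2/2+\beta^2/2)f_i(v)$, let $$\mathscr L(\mathbf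 X)=\mathbb E_\tau\Big[\prod_{i=1}^n\phi(X_i\mid\mu\Delta+\beta\tau_i,\tau_i)\Big]$$ be the likelihood (the expectation is over $\tau_1,\dots,\tau_n$ with $\mathbf X$ held fixed), $\phi(\cdot\mid m,v)$ being the normal density with mean $m$ and variance $v$, and let $$\mathscr Q_{\mathbf X}(d\mathbf y)=\frac{\pi^{-n}e^{-[\Lambda(\Omega_n)-n\bar A\beta]}\prod_{i=1}^n\cos(y_i|A_i|)\,dy_i}{\mathscr L(\mathbf X)}\quad\text{on }\mathbb R_+^n .$$ Integrals over $[0,\infty)$ and $\mathbb R_+^n$ are understood as limits of integrals over $[0,T]$ and over boxes $\prod_i[0,T_i]$ as $T,T_1,\dots,T_n\to\infty$ (they equal the Lebesgue integrals when the integrand is integrable). In (i) and (ii) the formulas are asserted, with convergence of all the integrals, for every $x\ne\mu\tilde\Delta$, and also for $x=\mu\tilde\Delta$ if $\int_0^\infty e^{-\Lambda((y^2/2+\beta^2/2)\tilde f)}dy<\infty$. **Proposition 2.3.** (i) $\tilde X$ has a (marginal) density with respect to Lebesgue measure, given by $$f_{\tilde X}(x\mid\beta,\mu)=\frac1\pi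 e^{(x-\mu\tilde\Delta)\beta}\int_0^\infty e^{-\Lambda((y^2/2+\beta^2/2)\tilde f)}\cos(y|x-\mu\tilde\Delta|)\,dy .$$ (ii) For almost every value of $\mathbf X$, the conditional distribution of $\tilde X$ given $\mathbf X$ has a density with respect to Lebesgue measure. A jointly measurable version of it is given, for every value of $\mathbf X$ with all $A_i\neq0$, by $$f_{\tilde X}(x\mid\beta,\mu,\mathbf X)=\frac1\pi e^{(x-\mu\tilde\Delta)\beta}\int_{\mathbb R_+^n}\Big[\int_0^\infty e^{-[\Lambda(w_{n+1}\tilde f+\Omega_n)-\Lambda(\Omega_n)]}\cos(y|x-\mu\tilde\Delta|)\,dy\Big]\mathscr Q_{\mathbf X}(d\mathbf y),\qquad w_{n+1}=\frac{y^2}2+\frac{\beta^2}2 .$$ -/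

import Mathlib

open MeasureTheory ProbabilityTheory Filter Topology Set
open scoped ENNReal NNReal

noncomputable section

/-- `N` is a Poisson random measure with mean intensity `ν`, defined on the probability
space `(Ω, P)`: it is a measurable map into measures, `N(A)` is Poisson distributed with mean
`ν A` whenever `ν A < ∞`, and the values of `N` on disjoint sets are independent.
(For σ-finite `ν` this forces `N(A) = ∞` almost surely when `ν A = ∞`.) -/
structure IsPoissonRandomMeasure {Ω V : Type*} [MeasurableSpace Ω] [MeasurableSpace V]
    (N : Ω → Measure V) (ν : Measure V) (P : Measure Ω) : Prop where
  measurable : Measurable N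
  map_apply : ∀ A : Set V, MeasurableSet A → ν A ≠ ∞ →
    P.map (fun ω => N ω A) = (poissonMeasure (ν A).toNNReal).map (fun k : ℕ => (k : ℝ≥0∞))
  indep : ∀ (k : ℕ) (A : Fin k → Set V), (∀ i, MeasurableSet (A i)) →
    Pairwise (fun i j => Disjoint (A i) (A j)) → iIndepFun (fun i ω => N ω (A i)) P

/-- The exponent `Λ(g) = ∫ (1 - e^{-g(x)}) ν(dx)`, for a non-negative function `g`. -/
def laplaceExponent {V : Type*} [MeasurableSpace V] (ν : Measure V) (g : V → ℝ) : ℝ≥0∞ :=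
  ∫⁻ x, ENNReal.ofReal (1 - Real.exp (-g x)) ∂ν

/-- The linear functional `N(g) = ∫ g(x) N(dx)`, for a non-negative function `g`
(the value `∞`, which is excluded almost surely when `Λ(g) < ∞`, is replaced by `0`). -/
def linearFunctional {Ω V : Type*} [MeasurableSpace V] (N : Ω → Measure V) (g : V → ℝ)
    (ω : Ω) : ℝ≥0 :=
  (∫⁻ x, ENNReal.ofReal (g x) ∂(N ω)).toNNReal

/-- The log-price variable `m + τ β + τ^{1/2} ε`. -/
def logPrice {Ω : Type*} (m β : ℝ) (τ : Ω → ℝ≥0) (ε : Ω → ℝ) (ω : Ω) : ℝ :=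
  m + (τ ω : ℝ) * β + Real.sqrt (τ ω : ℝ) * ε ω

/-- The weight `w = y² / 2 + β² / 2`. -/
def weight (β y : ℝ) : ℝ := y ^ 2 / 2 + β ^ 2 / 2

/-- `Ω_n(x) = ∑ i, (y_i² / 2 + β² / 2) f_i(x)`. -/
def weightedSum {V : Type*} {n : ℕ} (β : ℝ) (f : Fin n → V → ℝ) (y : Fin n → ℝ) (x : V) : ℝ :=
  ∑ i, weight β (y i) * f i x

/-- The likelihood of the data `a` when, given `τ_1, …, τ_n`, the observations are independent
and the `i`-th one is normal with mean `μΔ + β τ_i` and variance `τ_i`: the expectation over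
`τ_1, …, τ_n` of the product of these normal densities. -/
def likelihood {Ω : Type*} [MeasurableSpace Ω] {n : ℕ} (P : Measure Ω) (τ : Fin n → Ω → ℝ≥0)
    (μ β Δ : ℝ) (a : Fin n → ℝ) : ℝ :=
  ∫ ω, ∏ i, gaussianPDFReal (μ * Δ + β * τ i ω) (τ i ω) (a i) ∂P

/-- The (signed) Lebesgue density on `(0, ∞)^n` of the mixing measure `Q_X(dy)` at data `a`,
`π^{-n} e^{-[Λ(Ω_n) - ∑ A_i β]} ∏ cos(y_i |A_i|) / L(a)`, where `A_i = a_i - μΔ` and `L(a)` is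
the likelihood (note `∑ A_i = n Ā`). -/
def mixingDensity {Ω V : Type*} [MeasurableSpace Ω] [MeasurableSpace V] {n : ℕ} (P : Measure Ω)
    (N : Ω → Measure V) (ν : Measure V) (f : Fin n → V → ℝ) (μ β Δ : ℝ) (a y : Fin n → ℝ) : ℝ :=
  (Real.pi ^ n)⁻¹ *
      Real.exp (-((laplaceExponent ν (weightedSum β f y)).toReal - (∑ i, (a i - μ * Δ)) * β)) *
      (∏ i, Real.cos (y i * |a i - μ * Δ|)) /
    likelihood P (fun i => linearFunctional N (f i)) μ β Δ a

/-- `∫_0^∞ g(y) dy = I` as a possibly conditionally convergent integral, `lim_{T → ∞} ∫_0^T`. -/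
def HasHalfLineIntegral (g : ℝ → ℝ) (I : ℝ) : Prop :=
  (∀ T : ℝ, IntegrableOn g (Icc 0 T)) ∧
    Tendsto (fun T : ℝ => ∫ y in Icc 0 T, g y) atTop (𝓝 I)

/-- `∫_{(0,∞)^n} g(y) dy = I` as a possibly conditionally convergent integral: the limit of the
integrals over the boxes `[0,T_1] × ⋯ × [0,T_n]` as `T_1, …, T_n → ∞` independently. -/
def HasOrthantIntegral {n : ℕ} (g : (Fin n → ℝ) → ℝ) (I : ℝ) : Prop :=
  (∀ T : Fin n → ℝ, IntegrableOn g (Icc 0 T)) ∧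
    Tendsto (fun T : Fin n → ℝ => ∫ y in Icc 0 T, g y) atTop (𝓝 I)

/-- For a Lebesgue integrable function the half-line integral is the Lebesgue integral. -/
theorem HasHalfLineIntegral.iff_of_integrable {g : ℝ → ℝ} (hg : IntegrableOn g (Ici 0)) (I : ℝ) :
    HasHalfLineIntegral g I ↔ I = ∫ y in Ici 0, g y := by
  have hc : AECover (volume.restrict (Ici (0 : ℝ))) atTop (fun T : ℝ => Icc 0 T) :=
    { ae_eventually_mem := by
        filter_upwards [ae_restrict_mem measurableSet_Ici] with y hy
        filter_upwards [eventually_ge_atTop y] with T hT using ⟨hy, hT⟩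
      measurableSet := fun _ => measurableSet_Icc }
  have ht := hc.integral_tendsto_of_countably_generated hg
  have he : ∀ T : ℝ, (volume.restrict (Ici (0 : ℝ))).restrict (Icc 0 T)
      = volume.restrict (Icc 0 T) := fun T =>
    Measure.restrict_restrict_of_subset Icc_subset_Ici_self
  simp only [he] at ht
  refine ⟨fun h => tendsto_nhds_unique h.2 ht, ?_⟩
  rintro rfl
  exact ⟨fun T => hg.mono_set Icc_subset_Ici_self, ht⟩

/-- The filter `T_1, …, T_n → ∞` is countably generated. -/
theorem isCountablyGenerated_atTop_orthant (n : ℕ) :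
    (atTop : Filter (Fin n → ℝ)).IsCountablyGenerated := by
  have hb : (atTop : Filter (Fin n → ℝ)).HasBasis (fun _ : ℕ => True)
      (fun k => Ici (fun _ => (k : ℝ))) := by
    refine ⟨fun t => ⟨fun ht => ?_, ?_⟩⟩
    · obtain ⟨a, ha⟩ := mem_atTop_sets.1 ht
      obtain ⟨k, hk⟩ := exists_nat_ge (∑ i, |a i|)
      refine ⟨k, trivial, fun b hb => ha b fun i => ?_⟩
      exact ((le_abs_self _).trans ((Finset.single_le_sum (f := fun i => |a i|)
        (fun j _ => abs_nonneg _) (Finset.mem_univ i)).trans hk)).trans (hb i)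
    · rintro ⟨k, -, hk⟩
      exact mem_of_superset (Ici_mem_atTop _) hk
  exact HasCountableBasis.isCountablyGenerated ⟨hb, to_countable _⟩

/-- For a Lebesgue integrable function the orthant integral is the Lebesgue integral. -/
theorem HasOrthantIntegral.iff_of_integrable {n : ℕ} {g : (Fin n → ℝ) → ℝ}
    (hg : IntegrableOn g (Ici 0)) (I : ℝ) :
    HasOrthantIntegral g I ↔ I = ∫ y in Ici 0, g y := by
  have hc : AECover (volume.restrict (Ici (0 : Fin n → ℝ))) atTop (fun T => Icc 0 T) :=
    { ae_eventually_mem := by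
        filter_upwards [ae_restrict_mem measurableSet_Ici] with y hy
        filter_upwards [eventually_ge_atTop y] with T hT using ⟨hy, hT⟩
      measurableSet := fun _ => measurableSet_Icc }
  have := isCountablyGenerated_atTop_orthant n
  have ht := hc.integral_tendsto_of_countably_generated hg
  have he : ∀ T : Fin n → ℝ, (volume.restrict (Ici (0 : Fin n → ℝ))).restrict (Icc 0 T)
      = volume.restrict (Icc 0 T) := fun T =>
    Measure.restrict_restrict_of_subset Icc_subset_Ici_self
  simp only [he] at ht
  refine ⟨fun h => tendsto_nhds_unique h.2 ht, ?_⟩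
  rintro rfl
  exact ⟨fun T => hg.mono_set Icc_subset_Ici_self, ht⟩

end

/-! Given the variances, the observations are independent normals. For `t > 0`, Fourier inversion
writes the normal density with mean `m + βt` and variance `t` as `π⁻¹ e^{(x-m)β} ∫_0^∞
e^{-(y²/2+β²/2)t} cos(y|x-m|) dy` (`gaussianPDFReal_eq_cosTransformLim`,
`integral_Ici_exp_neg_weight_mul_cos`). The variance now enters only through an exponential. Putting
`t = N(f)`, averaging, and exchanging expectation with the `y`-integral leaves Laplace transforms of
`N`, which the Laplace functional `E e^{-N(g)} = e^{-Λ(g)}` evaluates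
(`IsPoissonRandomMeasure.lintegral_expNeg`). This gives the marginal density.

For the predictive density, `(X, Xt)` has as joint density the expectation of a product of normal
densities (`map_logPrice_eq_withDensity`), and the conditional density is its quotient by the
likelihood of `X` (`condDistrib_ae_eq_withDensity`). Rewriting every factor as a cosine integral
produces `e^{-Λ(w f̃ + Ω_n)}`; the factor `e^{-Λ(Ω_n)}` in the mixing measure cancels the
`e^{Λ(Ω_n)}` in the inner bracket.

The analytic difficulty is the exchange, since the `y`-integrals may converge only conditionally.
Integration by parts bounds the integral truncated at `T` by `1/|c|`, uniformly in `T` and `t`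
(`abs_cosTransform_le`), so Fubini on boxes followed by dominated convergence applies
(`hasHalfLineIntegral_integral`, `hasOrthantIntegral_integral`). At `c = 0` the extra integrability
assumption supplies the dominating function instead. -/

/-! ### Exponentials on `[0, ∞]` and the Poisson Laplace transform. -/

/-- The map `x ↦ e^{-x}` on `[0, ∞]`. -/
noncomputable def expNeg (x : ℝ≥0∞) : ℝ≥0∞ := EReal.exp (-(x : EReal))

theorem expNeg_coe (r : ℝ≥0) : expNeg r = ENNReal.ofReal (Real.exp (-(r : ℝ))) := rfl

theorem expNeg_ofReal {r : ℝ} (hr : 0 ≤ r) :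
    expNeg (ENNReal.ofReal r) = ENNReal.ofReal (Real.exp (-r)) := by
  rw [ENNReal.ofReal, expNeg_coe, Real.coe_toNNReal r hr]

theorem expNeg_of_ne_top {x : ℝ≥0∞} (hx : x ≠ ∞) :
    expNeg x = ENNReal.ofReal (Real.exp (-x.toReal)) := by
  lift x to ℝ≥0 using hx
  exact expNeg_coe x

@[simp] theorem expNeg_zero : expNeg 0 = 1 := by simp [expNeg]

@[simp] theorem expNeg_top : expNeg ∞ = 0 := by simp [expNeg]

theorem continuous_expNeg : Continuous expNeg :=
  ENNReal.continuous_exp.comp (continuous_neg.comp continuous_coe_ennreal_ereal)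

theorem measurable_expNeg : Measurable expNeg := continuous_expNeg.measurable

theorem antitone_expNeg : Antitone expNeg := fun x y h =>
  EReal.exp_monotone (EReal.neg_le_neg_iff.2 (by exact_mod_cast h))

theorem expNeg_le_one (x : ℝ≥0∞) : expNeg x ≤ 1 := by
  simpa using antitone_expNeg (bot_le : 0 ≤ x)

theorem expNeg_add (x y : ℝ≥0∞) : expNeg (x + y) = expNeg x * expNeg y := by
  induction x with
  | top => simp
  | coe x =>
    induction y with
    | top => simp
    | coe y =>
      rw [← ENNReal.coe_add, expNeg_coe, expNeg_coe, expNeg_coe,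
        ← ENNReal.ofReal_mul (Real.exp_nonneg _), ← Real.exp_add]
      congr 2
      push_cast; ring

theorem expNeg_sum {ι : Type*} (s : Finset ι) (f : ι → ℝ≥0∞) :
    expNeg (∑ i ∈ s, f i) = ∏ i ∈ s, expNeg (f i) := by
  classical
  induction s using Finset.induction_on with
  | empty => simp
  | insert i s hi ih => rw [Finset.sum_insert hi, Finset.prod_insert hi, expNeg_add, ih]

/-- The Laplace transform of the Poisson distribution. -/
theorem lintegral_expNeg_mul_poissonMeasure (r c : ℝ≥0) :
    ∫⁻ k : ℕ, expNeg (c * (k : ℝ≥0∞)) ∂(poissonMeasure r) = expNeg (r * (1 - expNeg c)) := by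
  have h1 : ∀ k : ℕ, expNeg (c * (k : ℝ≥0∞)) = ENNReal.ofReal (Real.exp (-c) ^ k) := by
    intro k
    have : (c : ℝ≥0∞) * (k : ℝ≥0∞) = ((c * k : ℝ≥0) : ℝ≥0∞) := by push_cast; rfl
    rw [this, expNeg_coe, ← Real.exp_nat_mul]
    push_cast; ring_nf
  have hs : HasSum
      (fun k : ℕ => Real.exp (-r) * (r : ℝ) ^ k / (k.factorial : ℝ) * Real.exp (-c) ^ k)
      (Real.exp (-r) * Real.exp (r * Real.exp (-c))) := by
    have := (NormedSpace.expSeries_div_hasSum_exp (r * Real.exp (-c) : ℝ)).mul_left (Real.exp (-r))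
    rw [← Real.exp_eq_exp_ℝ] at this
    refine this.congr_fun ?_
    intro k; rw [mul_pow]; ring
  have h2 : (r : ℝ≥0∞) * (1 - expNeg c) = ENNReal.ofReal (r * (1 - Real.exp (-c))) := by
    rw [expNeg_coe, ENNReal.ofReal_mul r.coe_nonneg, ENNReal.ofReal_sub _ (Real.exp_nonneg _)]
    simp
  have hle : Real.exp (-(c : ℝ)) ≤ 1 := Real.exp_le_one_iff.2 (by simp)
  rw [h2, expNeg_ofReal (mul_nonneg r.coe_nonneg (by linarith))]
  simp_rw [h1, poissonMeasure, lintegral_sum_measure, lintegral_smul_measure, lintegral_dirac,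
    smul_eq_mul]
  have : ∀ k : ℕ, ENNReal.ofReal (Real.exp (-r) * (r : ℝ) ^ k / (k.factorial : ℝ)) *
      ENNReal.ofReal (Real.exp (-c) ^ k) =
      ENNReal.ofReal (Real.exp (-r) * (r : ℝ) ^ k / (k.factorial : ℝ) * Real.exp (-c) ^ k) :=
    fun k => (ENNReal.ofReal_mul (by positivity)).symm
  simp_rw [this]
  rw [← ENNReal.ofReal_tsum_of_nonneg (fun k => by positivity) hs.summable, hs.tsum_eq,
    ← Real.exp_add]
  congr 2; ring

/-! ### The Laplace functional of a Poisson random measure. -/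

namespace IsPoissonRandomMeasure

variable {Ω V : Type*} [MeasurableSpace Ω] [MeasurableSpace V] {P : Measure Ω}
  {ν : Measure V} {N : Ω → Measure V}

theorem measurable_apply (hN : IsPoissonRandomMeasure N ν P) {A : Set V} (hA : MeasurableSet A) :
    Measurable fun ω => N ω A :=
  (Measure.measurable_coe hA).comp hN.measurable

theorem measurable_lintegral (hN : IsPoissonRandomMeasure N ν P) {g : V → ℝ≥0∞}
    (hg : Measurable g) : Measurable fun ω => ∫⁻ x, g x ∂(N ω) :=
  (Measure.measurable_lintegral hg).comp hN.measurable

theorem lintegral_expNeg_mul_apply (hN : IsPoissonRandomMeasure N ν P) {A : Set V}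
    (hA : MeasurableSet A) (hνA : ν A ≠ ∞) (c : ℝ≥0) :
    ∫⁻ ω, expNeg (c * N ω A) ∂P = expNeg (ν A * (1 - expNeg c)) := by
  have hm : Measurable fun x : ℝ≥0∞ => expNeg (c * x) :=
    measurable_expNeg.comp (measurable_const.mul measurable_id)
  rw [← lintegral_map (f := fun x : ℝ≥0∞ => expNeg (c * x)) hm (hN.measurable_apply hA),
    hN.map_apply A hA hνA, lintegral_map hm (by fun_prop), lintegral_expNeg_mul_poissonMeasure,
    ENNReal.coe_toNNReal hνA]

/-- The Laplace functional of a Poisson random measure, at a simple function with support of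
finite intensity. -/
theorem lintegral_expNeg_simpleFunc [IsProbabilityMeasure P]
    (hN : IsPoissonRandomMeasure N ν P) (s : SimpleFunc V ℝ≥0∞)
    (hs : ∀ x, s x ≠ ∞) (hν : ν {x | s x ≠ 0} ≠ ∞) :
    ∫⁻ ω, expNeg (∫⁻ x, s x ∂(N ω)) ∂P = expNeg (∫⁻ x, (1 - expNeg (s x)) ∂ν) := by
  have h1 : ∀ ω, expNeg (∫⁻ x, s x ∂(N ω)) =
      ∏ c : s.range, expNeg ((c : ℝ≥0∞) * N ω (s ⁻¹' {(c : ℝ≥0∞)})) := by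
    intro ω
    rw [SimpleFunc.lintegral_eq_lintegral, SimpleFunc.lintegral, expNeg_sum]
    exact (Finset.prod_coe_sort s.range
      (fun c => expNeg (c * N ω (s ⁻¹' {c})))).symm
  have h2 : ∫⁻ x, (1 - expNeg (s x)) ∂ν =
      ∑ c : s.range, (1 - expNeg (c : ℝ≥0∞)) * ν (s ⁻¹' {(c : ℝ≥0∞)}) := by
    have : ∀ x, 1 - expNeg (s x) = (s.map fun y => 1 - expNeg y) x := fun x => rfl
    simp_rw [this]
    rw [SimpleFunc.lintegral_eq_lintegral, SimpleFunc.map_lintegral]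
    exact (Finset.sum_coe_sort s.range (fun c => (1 - expNeg c) * ν (s ⁻¹' {c}))).symm
  -- Distinct level sets are disjoint, so the expectation of the product over levels will factorise.
  have hind : iIndepFun (fun (c : s.range) ω => N ω (s ⁻¹' {(c : ℝ≥0∞)})) P := by
    let e := Fintype.equivFin s.range
    have h := hN.indep _ (fun k => s ⁻¹' {((e.symm k : s.range) : ℝ≥0∞)})
      (fun k => s.measurableSet_preimage _) (fun i j hij => by
        refine Disjoint.preimage _ (disjoint_singleton.2 fun h => hij ?_)
        exact e.symm.injective (Subtype.ext h))
    have h' := h.precomp e.injective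
    simpa using h'
  simp_rw [h1]
  rw [lintegral_prod_eq_prod_lintegral_of_indepFun Finset.univ
      (fun (c : s.range) ω => expNeg ((c : ℝ≥0∞) * N ω (s ⁻¹' {(c : ℝ≥0∞)})))
      (hind.comp (fun c x => expNeg ((c : ℝ≥0∞) * x))
        (fun c => measurable_expNeg.comp (measurable_const.mul measurable_id)))
      (fun c => measurable_expNeg.comp (measurable_const.mul
        (hN.measurable_apply (s.measurableSet_preimage _)))), h2, expNeg_sum]
  refine Finset.prod_congr rfl fun c _ => ?_
  -- The zero level set may have infinite intensity, but it contributes the factor 1 on both sides.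
  by_cases hc : (c : ℝ≥0∞) = 0
  · simp [hc]
  · obtain ⟨x, hx⟩ := s.mem_range.1 c.2
    have hcT : (c : ℝ≥0∞) ≠ ∞ := hx ▸ hs x
    have hfin : ν (s ⁻¹' {(c : ℝ≥0∞)}) ≠ ∞ := by
      refine ne_top_of_le_ne_top hν (measure_mono fun y hy => ?_)
      rw [mem_preimage, mem_singleton_iff] at hy
      simpa [hy] using hc
    have := hN.lintegral_expNeg_mul_apply (s.measurableSet_preimage {(c : ℝ≥0∞)}) hfin
      (c : ℝ≥0∞).toNNReal
    rw [ENNReal.coe_toNNReal hcT] at this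
    rw [this, mul_comm]

/-- The Laplace functional of a Poisson random measure. -/
theorem lintegral_expNeg [IsProbabilityMeasure P] [SigmaFinite ν]
    (hN : IsPoissonRandomMeasure N ν P) {g : V → ℝ≥0∞} (hg : Measurable g) :
    ∫⁻ ω, expNeg (∫⁻ x, g x ∂(N ω)) ∂P = expNeg (∫⁻ x, (1 - expNeg (g x)) ∂ν) := by
  -- Cutting off to the spanning sets gives supports of finite intensity; the sequence still
  -- increases to `g`.
  let s : ℕ → SimpleFunc V ℝ≥0∞ := fun k => (SimpleFunc.eapprox g k).restrict (spanningSets ν k)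
  have hsa : ∀ k x, s k x = (spanningSets ν k).indicator (SimpleFunc.eapprox g k) x := fun k x =>
    SimpleFunc.restrict_apply _ (measurableSet_spanningSets ν k) x
  have hsm : ∀ x, Monotone fun k => s k x := by
    intro x i j hij
    simp only [hsa]
    exact (indicator_le_indicator_of_subset (monotone_spanningSets ν hij)
      (fun _ => bot_le) x).trans (indicator_le_indicator (SimpleFunc.monotone_eapprox g hij x))
  have hst : ∀ x, Tendsto (fun k => s k x) atTop (𝓝 (g x)) := by
    intro x
    have h1 : Tendsto (fun k => SimpleFunc.eapprox g k x) atTop (𝓝 (g x)) := by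
      rw [← SimpleFunc.iSup_eapprox_apply hg x]
      exact tendsto_atTop_iSup fun i j hij => SimpleFunc.monotone_eapprox g hij x
    refine h1.congr' ?_
    filter_upwards [eventually_ge_atTop (spanningSetsIndex ν x)] with k hk
    rw [hsa, indicator_of_mem (mem_spanningSets_of_index_le ν x hk)]
  have hN' : ∀ ω, Tendsto (fun k => ∫⁻ x, s k x ∂(N ω)) atTop (𝓝 (∫⁻ x, g x ∂(N ω))) := fun ω =>
    lintegral_tendsto_of_tendsto_of_monotone (fun k => (s k).measurable.aemeasurable)
      (ae_of_all _ hsm) (ae_of_all _ hst)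
  have hL : Tendsto (fun k => ∫⁻ ω, expNeg (∫⁻ x, s k x ∂(N ω)) ∂P) atTop
      (𝓝 (∫⁻ ω, expNeg (∫⁻ x, g x ∂(N ω)) ∂P)) := by
    -- `expNeg` reverses monotonicity, so this side uses domination by 1; on the other side `1 -
    -- expNeg` is increasing and monotone convergence applies.
    refine tendsto_lintegral_of_dominated_convergence (fun _ => 1)
      (fun k => measurable_expNeg.comp (hN.measurable_lintegral (s k).measurable))
      (fun k => ae_of_all _ fun ω => expNeg_le_one _) (by simp) (ae_of_all _ fun ω => ?_)
    exact (continuous_expNeg.tendsto _).comp (hN' ω)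
  have hR : Tendsto (fun k => expNeg (∫⁻ x, (1 - expNeg (s k x)) ∂ν)) atTop
      (𝓝 (expNeg (∫⁻ x, (1 - expNeg (g x)) ∂ν))) := by
    refine (continuous_expNeg.tendsto _).comp ?_
    refine lintegral_tendsto_of_tendsto_of_monotone
      (fun k => (measurable_const.sub (measurable_expNeg.comp (s k).measurable)).aemeasurable)
      (ae_of_all _ fun x i j hij => tsub_le_tsub_left (antitone_expNeg (hsm x hij)) 1)
      (ae_of_all _ fun x => ?_)
    exact ENNReal.Tendsto.sub tendsto_const_nhds ((continuous_expNeg.tendsto _).comp (hst x))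
      (Or.inl ENNReal.one_ne_top)
  refine tendsto_nhds_unique hL (hR.congr fun k =>
    (hN.lintegral_expNeg_simpleFunc (s k) ?_ ?_).symm)
  · intro x
    rw [hsa]
    exact ((indicator_le_self _ _ x).trans_lt (SimpleFunc.eapprox_lt_top g k x)).ne
  · refine ((measure_mono fun x hx => ?_).trans_lt (measure_spanningSets_lt_top ν k)).ne
    by_contra h
    exact hx (by rw [hsa, indicator_of_notMem h])

/-- Since `e^{-c N(g)}` vanishes where `N(g) = ∞`, `P(N(g) < ∞) ≥ E e^{-c N(g)}` for every `c > 0`.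
As `c → 0` the right side tends to 1, by domination of `1 - e^{-c g}` by `1 - e^{-g}`. -/
theorem ae_lintegral_ne_top [IsProbabilityMeasure P] [SigmaFinite ν]
    (hN : IsPoissonRandomMeasure N ν P) {g : V → ℝ≥0∞} (hg : Measurable g) (hgt : ∀ x, g x ≠ ∞)
    (hfin : ∫⁻ x, (1 - expNeg (g x)) ∂ν ≠ ∞) : ∀ᵐ ω ∂P, ∫⁻ x, g x ∂(N ω) ≠ ∞ := by
  let c : ℕ → ℝ≥0∞ := fun k => ((k : ℝ≥0∞) + 1)⁻¹
  have hc0 : ∀ k, c k ≠ 0 := fun k => by simp [c]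
  have hc1 : ∀ k, c k ≤ 1 := fun k => by simp [c]
  have hct : Tendsto c atTop (𝓝 0) := by
    have := ENNReal.tendsto_inv_nat_nhds_zero.comp (tendsto_add_atTop_nat 1)
    refine this.congr fun k => by simp [c]
  have hm : MeasurableSet {ω | ∫⁻ x, g x ∂(N ω) ≠ ∞} :=
    (measurableSet_singleton ∞).compl.preimage (hN.measurable_lintegral hg)
  have hle : ∀ k, expNeg (∫⁻ x, (1 - expNeg (c k * g x)) ∂ν) ≤
      P {ω | ∫⁻ x, g x ∂(N ω) ≠ ∞} := by
    intro k
    rw [← hN.lintegral_expNeg (hg.const_mul (c k)), ← lintegral_indicator_one hm]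
    refine lintegral_mono fun ω => ?_
    rw [lintegral_const_mul _ hg]
    by_cases h : ∫⁻ x, g x ∂(N ω) = ∞
    · simp [h, ENNReal.mul_top (hc0 k)]
    · rw [indicator_of_mem (by exact h)]
      exact expNeg_le_one _
  have hlim : Tendsto (fun k => expNeg (∫⁻ x, (1 - expNeg (c k * g x)) ∂ν)) atTop (𝓝 1) := by
    have h0 : Tendsto (fun k => ∫⁻ x, (1 - expNeg (c k * g x)) ∂ν) atTop
        (𝓝 (∫⁻ _, 0 ∂ν)) := by
      refine tendsto_lintegral_of_dominated_convergence (fun x => 1 - expNeg (g x))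
        (fun k => measurable_const.sub (measurable_expNeg.comp (hg.const_mul _)))
        (fun k => ae_of_all _ fun x => tsub_le_tsub_left (antitone_expNeg ?_) 1) hfin
        (ae_of_all _ fun x => ?_)
      · exact mul_le_of_le_one_left bot_le (hc1 k)
      · have h1 : Tendsto (fun k => c k * g x) atTop (𝓝 (0 * g x)) :=
          ENNReal.Tendsto.mul_const hct (Or.inr (hgt x))
        have h2 := ENNReal.Tendsto.sub (tendsto_const_nhds (x := (1 : ℝ≥0∞)))
          ((continuous_expNeg.tendsto _).comp h1) (Or.inl ENNReal.one_ne_top)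
        simpa using h2
    have h3 := (continuous_expNeg.tendsto _).comp h0
    simpa [Function.comp_def] using h3
  have h1 : P {ω | ∫⁻ x, g x ∂(N ω) ≠ ∞} = 1 :=
    le_antisymm prob_le_one (le_of_tendsto' hlim hle)
  exact (mem_ae_iff_prob_eq_one₀ hm.nullMeasurableSet).2 h1

end IsPoissonRandomMeasure

theorem laplaceExponent_eq {V : Type*} [MeasurableSpace V] (ν : Measure V) {g : V → ℝ}
    (hg : ∀ x, 0 ≤ g x) :
    laplaceExponent ν g = ∫⁻ x, (1 - expNeg (ENNReal.ofReal (g x))) ∂ν := by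
  refine lintegral_congr fun x => ?_
  rw [expNeg_ofReal (hg x), ENNReal.ofReal_sub _ (Real.exp_nonneg _), ENNReal.ofReal_one]

namespace IsPoissonRandomMeasure

variable {Ω V : Type*} [MeasurableSpace Ω] [MeasurableSpace V] {P : Measure Ω}
  {ν : Measure V} {N : Ω → Measure V}

theorem measurable_linearFunctional (hN : IsPoissonRandomMeasure N ν P) {g : V → ℝ}
    (hg : Measurable g) : Measurable (linearFunctional N g) :=
  (hN.measurable_lintegral hg.ennreal_ofReal).ennreal_toNNReal

theorem ae_linearFunctional_eq [IsProbabilityMeasure P] [SigmaFinite ν]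
    (hN : IsPoissonRandomMeasure N ν P) {g : V → ℝ} (hg : Measurable g) (hg0 : ∀ x, 0 ≤ g x)
    (hfin : laplaceExponent ν g ≠ ∞) :
    ∀ᵐ ω ∂P, ∫⁻ x, ENNReal.ofReal (g x) ∂(N ω) = linearFunctional N g ω := by
  rw [laplaceExponent_eq ν hg0] at hfin
  filter_upwards [hN.ae_lintegral_ne_top hg.ennreal_ofReal (fun x => ENNReal.ofReal_ne_top) hfin]
    with ω hω
  exact (ENNReal.coe_toNNReal hω).symm

/-- The Laplace transform of a random variable which is almost surely equal to `N(g)`. -/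
theorem exp_neg_laplaceExponent [IsProbabilityMeasure P] [SigmaFinite ν]
    (hN : IsPoissonRandomMeasure N ν P) {g : V → ℝ} (hg : Measurable g) (hg0 : ∀ x, 0 ≤ g x)
    {Y : Ω → ℝ} (hY0 : ∀ ω, 0 ≤ Y ω)
    (hY : ∀ᵐ ω ∂P, ∫⁻ x, ENNReal.ofReal (g x) ∂(N ω) = ENNReal.ofReal (Y ω)) :
    Real.exp (-(laplaceExponent ν g).toReal) = ∫ ω, Real.exp (-Y ω) ∂P := by
  have h1 := hN.lintegral_expNeg hg.ennreal_ofReal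
  rw [← laplaceExponent_eq ν hg0] at h1
  have h2 : ∫⁻ ω, expNeg (∫⁻ x, ENNReal.ofReal (g x) ∂(N ω)) ∂P =
      ∫⁻ ω, ENNReal.ofReal (Real.exp (-Y ω)) ∂P := by
    refine lintegral_congr_ae ?_
    filter_upwards [hY] with ω hω
    rw [hω, expNeg_ofReal (hY0 ω)]
  have hYm : AEMeasurable Y P := by
    refine (hN.measurable_lintegral hg.ennreal_ofReal).ennreal_toReal.aemeasurable.congr ?_
    filter_upwards [hY] with ω hω
    rw [hω, ENNReal.toReal_ofReal (hY0 ω)]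
  have hexp : AEMeasurable (fun ω => Real.exp (-Y ω)) P := by fun_prop
  -- An infinite exponent would force `E e^{-Y} = 0`, impossible for real-valued `Y`. Finiteness for
  -- all weighted sums thus comes for free, and `toReal` loses nothing.
  have hne : laplaceExponent ν g ≠ ∞ := by
    intro h
    rw [h, expNeg_top, h2, lintegral_eq_zero_iff' hexp.ennreal_ofReal] at h1
    have : ∀ᵐ ω ∂P, False := by
      filter_upwards [h1] with ω hω
      simp only [Pi.zero_apply, ENNReal.ofReal_eq_zero] at hω
      exact absurd hω (not_le.2 (Real.exp_pos _))
    exact (IsProbabilityMeasure.ne_zero P) (by simpa using this)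
  rw [integral_eq_lintegral_of_nonneg_ae (ae_of_all _ fun ω => Real.exp_nonneg _)
    hexp.aestronglyMeasurable, ← h2, h1, expNeg_of_ne_top hne,
    ENNReal.toReal_ofReal (Real.exp_nonneg _)]

end IsPoissonRandomMeasure

/-! ### Gaussian cosine transforms and their uniform bounds. -/

/-- The truncated oscillatory integral `∫_0^T e^{-(y²/2 + β²/2) t} cos (y c) dy`. -/
noncomputable def cosTransform (β c T t : ℝ) : ℝ :=
  ∫ y in Icc 0 T, Real.exp (-(weight β y * t)) * Real.cos (y * c)

/-- The value of `∫_0^∞ e^{-(y²/2 + β²/2) t} cos (y c) dy` for `t > 0`. -/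
noncomputable def cosTransformLim (β c t : ℝ) : ℝ :=
  Real.pi * (√(2 * Real.pi * t))⁻¹ * Real.exp (-c ^ 2 / (2 * t) - β ^ 2 * t / 2)

theorem weight_nonneg (β y : ℝ) : 0 ≤ weight β y := by unfold weight; positivity

theorem continuous_weight (β : ℝ) : Continuous (weight β) := by unfold weight; fun_prop

theorem measurable_weight (β : ℝ) : Measurable (weight β) := (continuous_weight β).measurable

theorem measurable_cosTransformLim (β c : ℝ) : Measurable (cosTransformLim β c) := by
  unfold cosTransformLim; fun_prop

/-- Expand the square, with `A = x - m`: `-(A - βt)²/(2t) = Aβ - A²/(2t) - β²t/2`. At `t = 0` both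
sides vanish because the inverse of 0 is 0, so no positivity is needed. -/
theorem gaussianPDFReal_eq_cosTransformLim (m β x : ℝ) (t : ℝ≥0) :
    gaussianPDFReal (m + β * t) t x =
      1 / Real.pi * Real.exp ((x - m) * β) * cosTransformLim β |x - m| t := by
  have hpi := Real.pi_ne_zero
  rcases eq_or_ne t 0 with rfl | ht
  · simp [cosTransformLim]
  have ht' : (t : ℝ) ≠ 0 := by exact_mod_cast ht
  have h : -(x - (m + β * t)) ^ 2 / (2 * t) =
      (x - m) * β + (-|x - m| ^ 2 / (2 * t) - β ^ 2 * t / 2) := by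
    rw [sq_abs]; field_simp; ring
  rw [gaussianPDFReal, cosTransformLim, h, Real.exp_add]
  field_simp

/-- Real part of the Fourier transform of a Gaussian. -/
theorem integral_exp_neg_mul_sq_mul_cos {b : ℝ} (hb : 0 < b) (c : ℝ) :
    ∫ y : ℝ, Real.exp (-b * y ^ 2) * Real.cos (y * c) =
      √(Real.pi / b) * Real.exp (-c ^ 2 / (4 * b)) := by
  have h := fourierIntegral_gaussian (b := (b : ℂ)) (by simpa using hb) (c : ℂ)
  have hR : ((Real.pi : ℂ) / b) ^ (1 / 2 : ℂ) * Complex.exp (-(c : ℂ) ^ 2 / (4 * b)) =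
      ((√(Real.pi / b) * Real.exp (-c ^ 2 / (4 * b)) : ℝ) : ℂ) := by
    rw [Real.sqrt_eq_rpow, Complex.ofReal_mul, Complex.ofReal_cpow (by positivity)]
    push_cast; rfl
  have hint : Integrable fun x : ℝ =>
      Complex.exp (Complex.I * c * x) * Complex.exp (-(b : ℂ) * x ^ 2) := by
    have := integrable_cexp_quadratic (b := (b : ℂ)) (by simpa using hb) (Complex.I * c) 0
    refine this.congr (ae_of_all _ fun x => ?_)
    simp only
    rw [← Complex.exp_add]; ring_nf
  rw [hR] at h
  have h2 := congrArg Complex.re h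
  rw [Complex.ofReal_re, ← RCLike.re_eq_complex_re, ← integral_re hint] at h2
  rw [← h2]
  refine integral_congr_ae (ae_of_all _ fun y => ?_)
  simp only [RCLike.re_eq_complex_re]
  have e1 : Complex.exp (-(b : ℂ) * y ^ 2) = ((Real.exp (-b * y ^ 2) : ℝ) : ℂ) := by push_cast; rfl
  have e2 : Complex.I * c * y = ((y * c : ℝ) : ℂ) * Complex.I := by push_cast; ring
  rw [e1, e2, Complex.re_mul_ofReal, Complex.exp_ofReal_mul_I_re, mul_comm]

theorem exp_neg_weight_mul (β y t : ℝ) :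
    Real.exp (-(weight β y * t)) = Real.exp (-(β ^ 2 * t / 2)) * Real.exp (-(t / 2) * y ^ 2) := by
  rw [← Real.exp_add, weight]; ring_nf

theorem integrable_exp_neg_weight (β : ℝ) {t : ℝ} (ht : 0 < t) :
    Integrable fun y => Real.exp (-(weight β y * t)) := by
  simp_rw [exp_neg_weight_mul]
  exact (integrable_exp_neg_mul_sq (half_pos ht)).const_mul _

theorem integrable_exp_neg_weight_mul_cos (β c : ℝ) {t : ℝ} (ht : 0 < t) :
    Integrable fun y => Real.exp (-(weight β y * t)) * Real.cos (y * c) := by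
  refine (integrable_exp_neg_weight β ht).mul_bdd (c := 1) (by fun_prop) (ae_of_all _ fun y => ?_)
  exact Real.abs_cos_le_one _

theorem integral_Ici_exp_neg_weight_mul_cos (β c : ℝ) {t : ℝ} (ht : 0 < t) :
    ∫ y in Ici 0, Real.exp (-(weight β y * t)) * Real.cos (y * c) = cosTransformLim β c t := by
  -- The integrand is even, so the half-line integral is half of the full Gaussian one.
  have h1 := integral_comp_abs (f := fun y => Real.exp (-(weight β y * t)) * Real.cos (y * c))
  have h2 : (fun y : ℝ => Real.exp (-(weight β |y| * t)) * Real.cos (|y| * c)) =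
      fun y => Real.exp (-(β ^ 2 * t / 2)) * (Real.exp (-(t / 2) * y ^ 2) * Real.cos (y * c)) := by
    funext y
    have : Real.cos (|y| * c) = Real.cos (y * c) := by
      rcases abs_choice y with h | h <;> simp [h]
    rw [exp_neg_weight_mul, sq_abs, this, mul_assoc]
  simp only [h2] at h1
  rw [integral_const_mul, integral_exp_neg_mul_sq_mul_cos (half_pos ht)] at h1
  rw [integral_Ici_eq_integral_Ioi, cosTransformLim]
  have h3 : √(Real.pi / (t / 2)) = 2 * (Real.pi * (√(2 * Real.pi * t))⁻¹) := by
    have hpos : 0 < 2 * Real.pi * t := by positivity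
    have hs : 0 < √(2 * Real.pi * t) := Real.sqrt_pos.2 hpos
    rw [Real.sqrt_eq_iff_mul_self_eq (by positivity) (by positivity)]
    field_simp
    exact Real.sq_sqrt (by positivity)
  have h4 : Real.exp (-c ^ 2 / (2 * t) - β ^ 2 * t / 2) =
      Real.exp (-(β ^ 2 * t / 2)) * Real.exp (-c ^ 2 / (4 * (t / 2))) := by
    rw [← Real.exp_add]; congr 1; field_simp; ring
  rw [h3] at h1
  rw [h4]
  linarith

theorem tendsto_cosTransform (β c : ℝ) {t : ℝ} (ht : 0 < t) :
    Tendsto (fun T => cosTransform β c T t) atTop (𝓝 (cosTransformLim β c t)) :=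
  ((HasHalfLineIntegral.iff_of_integrable
    (integrable_exp_neg_weight_mul_cos β c ht).integrableOn _).2
      (integral_Ici_exp_neg_weight_mul_cos β c ht).symm).2

/-- Replace the cosine by 1 and extend to the half-line. Unlike the oscillatory bound below, this
survives at `c = 0`, but it is unbounded as `t → 0`. -/
theorem abs_cosTransform_le_lim_zero (β c T : ℝ) {t : ℝ} (ht : 0 < t) :
    |cosTransform β c T t| ≤ cosTransformLim β 0 t := by
  have h0 := integral_Ici_exp_neg_weight_mul_cos β 0 ht
  simp only [mul_zero, Real.cos_zero, mul_one] at h0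
  rw [← h0, ← Real.norm_eq_abs]
  refine (norm_integral_le_integral_norm _).trans ?_
  refine (integral_mono_ae (integrable_exp_neg_weight_mul_cos β c ht).integrableOn.norm
    (integrable_exp_neg_weight β ht).integrableOn (ae_of_all _ fun y => ?_)).trans
    (setIntegral_mono_set (integrable_exp_neg_weight β ht).integrableOn
      (ae_of_all _ fun y => Real.exp_nonneg _) (Icc_subset_Ici_self.eventuallyLE))
  simp only [norm_mul, Real.norm_eq_abs, Real.abs_exp]
  exact mul_le_of_le_one_right (Real.exp_nonneg _) (Real.abs_cos_le_one _)

/-- Integrate by parts against `sin(yc)/c`. With `u(y) = e^{-w t}` decreasing in `y`, the boundary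
term is at most `u(T)/|c|` and the remaining integral at most `(u(0) - u(T))/|c|`; they add up to
`u(0)/|c| ≤ 1/|c|`. -/
theorem abs_cosTransform_le (β T : ℝ) {c t : ℝ} (hc : c ≠ 0) (ht : 0 ≤ t) :
    |cosTransform β c T t| ≤ |c|⁻¹ := by
  rcases lt_or_ge T 0 with hT | hT
  · simp [cosTransform, Icc_eq_empty (not_le.2 hT)]
  rw [cosTransform, integral_Icc_eq_integral_Ioc, ← intervalIntegral.integral_of_le hT]
  set u : ℝ → ℝ := fun y => Real.exp (-(weight β y * t)) with hu
  set u' : ℝ → ℝ := fun y => -(u y * (y * t)) with hu'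
  have hdu : ∀ y, HasDerivAt u (u' y) y := by
    intro y
    have h1 : HasDerivAt (fun y => -(weight β y * t)) (-(y * t)) y := by
      have := ((((hasDerivAt_pow 2 y).div_const 2).add_const (β ^ 2 / 2)).mul_const t).neg
      convert! this using 1
      push_cast; ring
    convert! h1.exp using 1
    simp only [hu', hu]; ring
  have hdv : ∀ y, HasDerivAt (fun y => Real.sin (y * c) / c) (Real.cos (y * c)) y := by
    intro y
    have h1 : HasDerivAt (fun y => y * c) c y := by simpa using (hasDerivAt_id y).mul_const c
    convert! h1.sin.div_const c using 1
    field_simp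
  have hcu : Continuous u := by have := continuous_weight β; fun_prop
  have hcu' : Continuous u' := by fun_prop
  have hparts := intervalIntegral.integral_mul_deriv_eq_deriv_mul (a := 0) (b := T)
    (fun y _ => hdu y) (fun y _ => hdv y) (hcu'.intervalIntegrable _ _)
    (Continuous.intervalIntegrable (by fun_prop) _ _)
  rw [hparts]
  have hFTC := intervalIntegral.integral_eq_sub_of_hasDerivAt (a := 0) (b := T)
    (fun y _ => hdu y) (hcu'.intervalIntegrable _ _)
  have hbound : |∫ y in (0 : ℝ)..T, u' y * (Real.sin (y * c) / c)| ≤ (u 0 - u T) * |c|⁻¹ := by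
    have : (u 0 - u T) * |c|⁻¹ = ∫ y in (0 : ℝ)..T, -u' y * |c|⁻¹ := by
      rw [intervalIntegral.integral_mul_const, intervalIntegral.integral_neg, hFTC]; ring
    rw [this, ← Real.norm_eq_abs]
    refine intervalIntegral.norm_integral_le_of_norm_le hT (ae_of_all _ fun y hy => ?_)
      (Continuous.intervalIntegrable (by fun_prop) _ _)
    have h0 : u' y ≤ 0 := by
      simp only [hu', hu]
      have := mul_nonneg (Real.exp_nonneg (-(weight β y * t))) (mul_nonneg hy.1.le ht)
      linarith
    rw [norm_mul, Real.norm_of_nonpos h0, norm_div, div_eq_mul_inv, Real.norm_eq_abs c]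
    refine mul_le_mul_of_nonneg_left ?_ (by linarith)
    exact mul_le_of_le_one_left (by positivity) (Real.abs_sin_le_one _)
  have hu0 : u 0 ≤ 1 := Real.exp_le_one_iff.2 (neg_nonpos.2 (mul_nonneg (weight_nonneg _ _) ht))
  have huT : 0 ≤ u T := Real.exp_nonneg _
  have hb2 : |u T * (Real.sin (T * c) / c)| ≤ u T * |c|⁻¹ := by
    rw [abs_mul, abs_of_nonneg huT, abs_div, div_eq_mul_inv]
    refine mul_le_mul_of_nonneg_left ?_ huT
    exact mul_le_of_le_one_left (by positivity) (Real.abs_sin_le_one _)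
  simp only [zero_mul, Real.sin_zero, zero_div, mul_zero, sub_zero]
  calc _ ≤ |u T * (Real.sin (T * c) / c)| + |∫ y in (0 : ℝ)..T, u' y * (Real.sin (y * c) / c)| :=
        abs_sub _ _
    _ ≤ u T * |c|⁻¹ + (u 0 - u T) * |c|⁻¹ := add_le_add hb2 hbound
    _ = u 0 * |c|⁻¹ := by ring
    _ ≤ |c|⁻¹ := mul_le_of_le_one_left (by positivity) hu0

theorem measurable_cosTransform (β c T : ℝ) : Measurable (cosTransform β c T) := by
  have : StronglyMeasurable fun p : ℝ × ℝ =>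
      Real.exp (-(weight β p.2 * p.1)) * Real.cos (p.2 * c) := by
    have := measurable_weight β
    exact Measurable.stronglyMeasurable (by fun_prop)
  exact (this.integral_prod_right (ν := volume.restrict (Icc 0 T))).measurable

/-! ### Exchanging expectation with conditionally convergent integrals. -/

/-- Fubini is legitimate on `[0, T]`, where the integrand is bounded on a finite measure space; then
`T → ∞` by domination by `B`. The factor `G` is 1 for the marginal density and carries the observed
variances for the predictive one. -/
theorem hasHalfLineIntegral_integral {Ω : Type*} [MeasurableSpace Ω] {P : Measure Ω}
    [IsProbabilityMeasure P] {β c : ℝ} {S G B : Ω → ℝ} (hS : Measurable S)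
    (hSpos : ∀ᵐ ω ∂P, 0 < S ω) (hG : Measurable G) (hG1 : ∀ ω, |G ω| ≤ 1)
    (hB : Integrable B P) (hSB : ∀ᵐ ω ∂P, ∀ T, |cosTransform β c T (S ω)| ≤ B ω) :
    HasHalfLineIntegral
      (fun y => (∫ ω, Real.exp (-(weight β y * S ω)) * G ω ∂P) * Real.cos (y * c))
      (∫ ω, cosTransformLim β c (S ω) * G ω ∂P) := by
  have hw := measurable_weight β
  have hint : ∀ T : ℝ, Integrable (fun p : Ω × ℝ =>
      Real.exp (-(weight β p.2 * S p.1)) * G p.1 * Real.cos (p.2 * c))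
      (P.prod (volume.restrict (Icc 0 T))) := by
    intro T
    have hae : ∀ᵐ p : Ω × ℝ ∂(P.prod (volume.restrict (Icc 0 T))), 0 < S p.1 :=
      Measure.quasiMeasurePreserving_fst.ae hSpos
    refine Integrable.of_bound (by fun_prop) 1 ?_
    filter_upwards [hae] with p hp
    rw [norm_mul, norm_mul, Real.norm_eq_abs, Real.abs_exp]
    refine mul_le_one₀ (mul_le_one₀ ?_ (norm_nonneg _) (hG1 _)) (norm_nonneg _)
      (Real.abs_cos_le_one _)
    exact Real.exp_le_one_iff.2 (neg_nonpos.2 (mul_nonneg (weight_nonneg _ _) hp.le))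
  have hpull : ∀ y, (∫ ω, Real.exp (-(weight β y * S ω)) * G ω ∂P) * Real.cos (y * c) =
      ∫ ω, Real.exp (-(weight β y * S ω)) * G ω * Real.cos (y * c) ∂P := fun y =>
    (integral_mul_const _ _).symm
  have hval : ∀ T : ℝ, ∫ y in Icc 0 T,
      (∫ ω, Real.exp (-(weight β y * S ω)) * G ω ∂P) * Real.cos (y * c) =
      ∫ ω, cosTransform β c T (S ω) * G ω ∂P := by
    intro T
    simp_rw [hpull]
    rw [← integral_integral_swap (hint T)]
    refine integral_congr_ae (ae_of_all _ fun ω => ?_)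
    simp only [cosTransform]
    rw [← integral_mul_const]
    refine integral_congr_ae (ae_of_all _ fun y => ?_)
    simp only; ring
  refine ⟨fun T => ?_, ?_⟩
  · simp_rw [hpull]
    exact (hint T).integral_prod_right
  · simp_rw [hval]
    refine tendsto_integral_filter_of_dominated_convergence B
      (Eventually.of_forall fun T =>
        (((measurable_cosTransform β c T).comp hS).mul hG).aestronglyMeasurable)
      (Eventually.of_forall fun T => ?_) hB ?_
    · filter_upwards [hSB] with ω hω
      rw [norm_mul]
      exact (mul_le_of_le_one_right (norm_nonneg _) (hG1 ω)).trans (hω T)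
    · filter_upwards [hSpos] with ω hω
      exact (tendsto_cosTransform β c hω).mul_const _

/-- A dominating function for the truncated cosine transforms of a positive random variable. -/
theorem exists_bound_cosTransform {Ω : Type*} [MeasurableSpace Ω] {P : Measure Ω}
    [IsProbabilityMeasure P] {β c : ℝ} {S : Ω → ℝ} (hS : Measurable S)
    (hSpos : ∀ᵐ ω ∂P, 0 < S ω)
    (hc : c ≠ 0 ∨ IntegrableOn (fun y => ∫ ω, Real.exp (-(weight β y * S ω)) ∂P) (Ioi 0)) :
    ∃ B : Ω → ℝ, Integrable B P ∧ (∀ᵐ ω ∂P, ∀ T, |cosTransform β c T (S ω)| ≤ B ω) := by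
  have hw := measurable_weight β
  rcases hc with hc | hc
  · refine ⟨fun _ => |c|⁻¹, integrable_const _, ?_⟩
    filter_upwards [hSpos] with ω hω T using abs_cosTransform_le β T hc hω.le
  refine ⟨fun ω => cosTransformLim β 0 (S ω), ?_, ?_⟩
  · have hexp : ∀ y, Integrable (fun ω => Real.exp (-(weight β y * S ω))) P := by
      intro y
      refine Integrable.of_bound (by fun_prop) 1 ?_
      filter_upwards [hSpos] with ω hω
      rw [Real.norm_eq_abs, Real.abs_exp]
      exact Real.exp_le_one_iff.2 (neg_nonpos.2 (mul_nonneg (weight_nonneg _ _) hω.le))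
    -- Tonelli turns integrability in `y` of the expectation into integrability in `ω` of the
    -- `y`-integral, which is `cosTransformLim β 0`.
    have hprod : Integrable (fun p : Ω × ℝ => Real.exp (-(weight β p.2 * S p.1)))
        (P.prod (volume.restrict (Ioi 0))) := by
      refine (integrable_prod_iff' (Measurable.aestronglyMeasurable (by fun_prop))).2
        ⟨ae_of_all _ hexp, ?_⟩
      simpa only [Real.norm_eq_abs, Real.abs_exp] using! hc
    refine hprod.integral_prod_left.congr ?_
    filter_upwards [hSpos] with ω hω
    have := integral_Ici_exp_neg_weight_mul_cos β 0 hω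
    rw [integral_Ici_eq_integral_Ioi] at this
    simpa using this
  · filter_upwards [hSpos] with ω hω T using abs_cosTransform_le_lim_zero β c T hω

theorem integrable_cosTransformLim {Ω : Type*} [MeasurableSpace Ω] {P : Measure Ω}
    {β c : ℝ} {S B : Ω → ℝ} (hS : Measurable S)
    (hSpos : ∀ᵐ ω ∂P, 0 < S ω) (hB : Integrable B P)
    (hSB : ∀ᵐ ω ∂P, ∀ T, |cosTransform β c T (S ω)| ≤ B ω) :
    Integrable (fun ω => cosTransformLim β c (S ω)) P := by
  refine hB.mono' ((measurable_cosTransformLim β c).comp hS).aestronglyMeasurable ?_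
  filter_upwards [hSpos, hSB] with ω hω hb
  exact le_of_tendsto' (tendsto_cosTransform β c hω).norm hb

/-- Over a box the integral factorises into truncated cosine transforms, each bounded by `1/|c i|`,
so `|H| ∏ 1/|c i|` dominates. `H` will be the cosine transform of the new observation. -/
theorem hasOrthantIntegral_integral {Ω : Type*} [MeasurableSpace Ω] {P : Measure Ω}
    [IsProbabilityMeasure P] {n : ℕ} {β : ℝ} {c : Fin n → ℝ} (hc : ∀ i, c i ≠ 0)
    {S : Fin n → Ω → ℝ} {H : Ω → ℝ} (hS : ∀ i, Measurable (S i))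
    (hSpos : ∀ i, ∀ᵐ ω ∂P, 0 < S i ω) (hH : Integrable H P) :
    HasOrthantIntegral
      (fun ys => ∫ ω, H ω *
        ∏ i, (Real.exp (-(weight β (ys i) * S i ω)) * Real.cos (ys i * c i)) ∂P)
      (∫ ω, H ω * ∏ i, cosTransformLim β (c i) (S i ω) ∂P) := by
  have hw := measurable_weight β
  have hpos : ∀ᵐ ω ∂P, ∀ i, 0 < S i ω := ae_all_iff.2 hSpos
  have hint : ∀ T : Fin n → ℝ, Integrable (fun p : Ω × (Fin n → ℝ) => H p.1 *
        ∏ i, (Real.exp (-(weight β (p.2 i) * S i p.1)) * Real.cos (p.2 i * c i)))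
      (P.prod (volume.restrict (Icc 0 T))) := by
    intro T
    have : IsFiniteMeasure ((volume : Measure (Fin n → ℝ)).restrict (Icc 0 T)) :=
      ⟨by simpa using! isCompact_Icc.measure_lt_top⟩
    have hae : ∀ᵐ p : Ω × (Fin n → ℝ) ∂(P.prod (volume.restrict (Icc 0 T))), ∀ i, 0 < S i p.1 :=
      Measure.quasiMeasurePreserving_fst.ae hpos
    refine (hH.comp_fst _).mul_bdd (c := 1) (Measurable.aestronglyMeasurable (by fun_prop)) ?_
    filter_upwards [hae] with p hp
    rw [norm_prod]
    refine Finset.prod_le_one (fun i _ => norm_nonneg _) fun i _ => ?_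
    rw [norm_mul, Real.norm_eq_abs, Real.abs_exp]
    refine mul_le_one₀ ?_ (norm_nonneg _) (Real.abs_cos_le_one _)
    exact Real.exp_le_one_iff.2 (neg_nonpos.2 (mul_nonneg (weight_nonneg _ _) (hp i).le))
  have hval : ∀ T : Fin n → ℝ, ∫ ys in Icc 0 T, (∫ ω, H ω *
        ∏ i, (Real.exp (-(weight β (ys i) * S i ω)) * Real.cos (ys i * c i)) ∂P) =
      ∫ ω, H ω * ∏ i, cosTransform β (c i) (T i) (S i ω) ∂P := by
    intro T
    rw [← integral_integral_swap (hint T)]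
    refine integral_congr_ae (ae_of_all _ fun ω => ?_)
    simp only [cosTransform]
    rw [integral_const_mul, ← pi_univ_Icc, volume_pi, Measure.restrict_pi_pi]
    simp only [Pi.zero_apply]
    rw [integral_fintype_prod_eq_prod
      (f := fun i y => Real.exp (-(weight β y * S i ω)) * Real.cos (y * c i))]
  refine ⟨fun T => (hint T).integral_prod_right, ?_⟩
  simp_rw [hval]
  have := isCountablyGenerated_atTop_orthant n
  refine tendsto_integral_filter_of_dominated_convergence (fun ω => ‖H ω‖ * ∏ i, |c i|⁻¹)
    (Eventually.of_forall fun T => hH.aestronglyMeasurable.mul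
      (Finset.aestronglyMeasurable_fun_prod _ fun i _ =>
        ((measurable_cosTransform β (c i) (T i)).comp (hS i)).aestronglyMeasurable))
    (Eventually.of_forall fun T => ?_) (hH.norm.mul_const _) ?_
  · filter_upwards [hpos] with ω hω
    rw [norm_mul, norm_prod]
    exact mul_le_mul_of_nonneg_left (Finset.prod_le_prod (fun i _ => norm_nonneg _)
      fun i _ => abs_cosTransform_le β (T i) (hc i) (hω i).le) (norm_nonneg _)
  · filter_upwards [hpos] with ω hω
    refine Tendsto.const_mul _ (tendsto_finsetProd _ fun i _ => ?_)
    exact (tendsto_cosTransform β (c i) (hω i)).comp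
      (tendsto_atTop.2 fun b => (eventually_ge_atTop fun _ => b).mono fun T hT => hT i)

/-! ### The joint density of the data and the new observation. -/

theorem map_affine_gaussianReal (m β : ℝ) (t : ℝ≥0) :
    (gaussianReal 0 1).map (fun e => m + t * β + √(t : ℝ) * e) = gaussianReal (m + β * t) t := by
  have h : (fun e : ℝ => m + t * β + √(t : ℝ) * e) =
      (fun y => (m + t * β) + y) ∘ (fun e => √(t : ℝ) * e) := rfl
  rw [h, ← Measure.map_map (by fun_prop) (by fun_prop), gaussianReal_map_const_mul,
    gaussianReal_map_const_add]
  congr 1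
  · ring
  · ext; simp [Real.sq_sqrt t.coe_nonneg]

theorem pi_gaussianReal_eq_withDensity {ι : Type*} [Fintype ι] (m : ι → ℝ) {v : ι → ℝ≥0}
    (hv : ∀ i, v i ≠ 0) :
    Measure.pi (fun i => gaussianReal (m i) (v i)) =
      volume.withDensity fun a => ∏ i, gaussianPDF (m i) (v i) (a i) := by
  refine Measure.pi_eq fun s hs => ?_
  rw [withDensity_apply _ (MeasurableSet.univ_pi hs), volume_pi, Measure.restrict_pi_pi]
  have h1 : ∀ a : ι → ℝ, ∏ i, gaussianPDF (m i) (v i) (a i) =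
      ENNReal.ofReal (∏ i, gaussianPDFReal (m i) (v i) (a i)) := fun a =>
    (ENNReal.ofReal_prod_of_nonneg fun i _ => gaussianPDFReal_nonneg _ _ _).symm
  simp_rw [h1]
  rw [← ofReal_integral_eq_lintegral_ofReal
      (Integrable.fintype_prod (f := fun i => gaussianPDFReal (m i) (v i))
        fun i => (integrable_gaussianPDFReal _ _).integrableOn)
      (ae_of_all _ fun a => Finset.prod_nonneg fun i _ => gaussianPDFReal_nonneg _ _ _),
    integral_fintype_prod_eq_prod (f := fun i => gaussianPDFReal (m i) (v i)),
    ENNReal.ofReal_prod_of_nonneg fun i _ =>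
      integral_nonneg fun a => gaussianPDFReal_nonneg _ _ _]
  exact Finset.prod_congr rfl fun i _ => (gaussianReal_apply_eq_integral _ (hv i) _).symm

/-- The joint density of observations and a new observation which are conditionally independent
and normal given the variances. -/
noncomputable def jointDensity {Ω : Type*} [MeasurableSpace Ω] {n : ℕ} (P : Measure Ω) (m mt β : ℝ)
    (τ : Fin n → Ω → ℝ≥0) (τt : Ω → ℝ≥0) (z : (Fin n → ℝ) × ℝ) : ℝ≥0∞ :=
  ∫⁻ ω, (∏ i, gaussianPDF (m + β * τ i ω) (τ i ω) (z.1 i)) *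
    gaussianPDF (mt + β * τt ω) (τt ω) z.2 ∂P

section

variable {Ω : Type*} [MeasurableSpace Ω] {n : ℕ} {P : Measure Ω} [IsProbabilityMeasure P]
  {m mt β : ℝ} {τ : Fin n → Ω → ℝ≥0} {τt : Ω → ℝ≥0}

theorem measurable_gaussianPDF_comp {α : Type*} [MeasurableSpace α] {t : α → ℝ≥0} {y : α → ℝ}
    (ht : Measurable t) (hy : Measurable y) :
    Measurable fun z => gaussianPDF (m + β * t z) (t z) (y z) :=
  measurable_uncurry_gaussianPDF.comp
    (((ht.coe_nnreal_real.const_mul β).const_add m).prodMk (ht.prodMk hy))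

theorem measurable_prod_gaussianPDF_mul {α : Type*} [MeasurableSpace α] {t : Fin n → α → ℝ≥0}
    {tt : α → ℝ≥0} {y : Fin n → α → ℝ} {x : α → ℝ} (ht : ∀ i, Measurable (t i))
    (htt : Measurable tt) (hy : ∀ i, Measurable (y i)) (hx : Measurable x) :
    Measurable fun z => (∏ i, gaussianPDF (m + β * t i z) (t i z) (y i z)) *
      gaussianPDF (mt + β * tt z) (tt z) (x z) :=
  (Finset.measurable_fun_prod _ fun i _ => measurable_gaussianPDF_comp (ht i) (hy i)).mul
    (measurable_gaussianPDF_comp htt hx)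

theorem measurable_jointDensity (hτ : ∀ i, Measurable (τ i)) (hτt : Measurable τt) :
    Measurable (jointDensity P m mt β τ τt) := by
  have h : Measurable fun q : ((Fin n → ℝ) × ℝ) × Ω =>
      (∏ i, gaussianPDF (m + β * τ i q.2) (τ i q.2) (q.1.1 i)) *
        gaussianPDF (mt + β * τt q.2) (τt q.2) q.1.2 :=
    measurable_prod_gaussianPDF_mul (fun i => (hτ i).comp measurable_snd)
      (hτt.comp measurable_snd)
      (fun i => (measurable_pi_apply i).comp (measurable_fst.comp measurable_fst))
      (measurable_snd.comp measurable_fst)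
  exact h.lintegral_prod_right'

/-- By independence, the law is an integral over the variances of product normal laws. These have
densities for almost all variances, and Tonelli moves the average over variances onto the densities.
-/
theorem map_logPrice_eq_withDensity (hτ : ∀ i, Measurable (τ i)) (hτt : Measurable τt)
    (hτ_pos : ∀ i, ∀ᵐ ω ∂P, 0 < τ i ω) (hτt_pos : ∀ᵐ ω ∂P, 0 < τt ω)
    {ε : Fin n → Ω → ℝ} {εt : Ω → ℝ} (hε : ∀ i, HasLaw (ε i) (gaussianReal 0 1) P)
    (hεt : HasLaw εt (gaussianReal 0 1) P) (hε_indep : iIndepFun ε P)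
    (hτε : IndepFun (fun ω => ((fun i => τ i ω), τt ω)) (fun ω i => ε i ω) P)
    (hεt_indep : IndepFun εt (fun ω => (((fun i => τ i ω), τt ω), fun i => ε i ω)) P) :
    P.map (fun ω => ((fun i => logPrice m β (τ i) (ε i) ω), logPrice mt β τt εt ω)) =
      (volume.prod volume).withDensity (jointDensity P m mt β τ τt) := by
  have hTm : Measurable fun ω => ((fun i => τ i ω), τt ω) :=
    (measurable_pi_lambda _ hτ).prodMk hτt
  have hεm : AEMeasurable (fun ω i => ε i ω) P :=
    aemeasurable_pi_lambda _ fun i => (hε i).aemeasurable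
  have hlaw : P.map (fun ω => (εt ω, (((fun i => τ i ω), τt ω), fun i => ε i ω))) =
      (gaussianReal 0 1).prod ((P.map fun ω => ((fun i => τ i ω), τt ω)).prod
        (Measure.pi fun _ : Fin n => gaussianReal 0 1)) := by
    rw [(indepFun_iff_map_prod_eq_prod_map_map hεt.aemeasurable
      (hTm.aemeasurable.prodMk hεm)).1 hεt_indep,
      (indepFun_iff_map_prod_eq_prod_map_map hTm.aemeasurable hεm).1 hτε, hεt.map_eq,
      hε_indep.map_fun_eq_pi_map fun i => (hε i).aemeasurable]
    simp_rw [fun i => (hε i).map_eq]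
  let Φ : ℝ × (((Fin n → ℝ≥0) × ℝ≥0) × (Fin n → ℝ)) → (Fin n → ℝ) × ℝ := fun z =>
    (fun i => m + z.2.1.1 i * β + √(z.2.1.1 i : ℝ) * z.2.2 i,
      mt + z.2.1.2 * β + √(z.2.1.2 : ℝ) * z.1)
  have hΦ : Measurable Φ := by fun_prop
  have hmap : P.map (fun ω => ((fun i => logPrice m β (τ i) (ε i) ω), logPrice mt β τt εt ω)) =
      (P.map (fun ω => (εt ω, (((fun i => τ i ω), τt ω), fun i => ε i ω)))).map Φ := by
    rw [AEMeasurable.map_map_of_aemeasurable hΦ.aemeasurable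
      (hεt.aemeasurable.prodMk (hTm.aemeasurable.prodMk hεm))]
    rfl
  have hPm : IsProbabilityMeasure (P.map fun ω => ((fun i => τ i ω), τt ω)) :=
    Measure.isProbabilityMeasure_map hTm.aemeasurable
  refine Measure.ext_of_lintegral _ fun h hh => ?_
  have hhΦ : Measurable fun z => h (Φ z) := hh.comp hΦ
  rw [hmap, hlaw, lintegral_map hh hΦ, lintegral_prod_symm (fun z => h (Φ z)) hhΦ.aemeasurable,
    lintegral_prod _ hhΦ.lintegral_prod_left'.aemeasurable, lintegral_map
      hhΦ.lintegral_prod_left'.lintegral_prod_right' hTm,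
    lintegral_withDensity_eq_lintegral_mul _ (measurable_jointDensity hτ hτt) hh]
  -- A normal law of variance 0 is a Dirac mass, so these `ω` must be discarded.
  have hpos : ∀ᵐ ω ∂P, (∀ i, τ i ω ≠ 0) ∧ τt ω ≠ 0 := by
    filter_upwards [ae_all_iff.2 hτ_pos, hτt_pos] with ω h1 h2 using ⟨fun i => (h1 i).ne', h2.ne'⟩
  have hinner : ∀ ω, (∀ i, τ i ω ≠ 0) ∧ τt ω ≠ 0 →
      ∫⁻ u, ∫⁻ e, h (Φ (e, (((fun i => τ i ω), τt ω), u))) ∂(gaussianReal 0 1)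
        ∂(Measure.pi fun _ : Fin n => gaussianReal 0 1) =
      ∫⁻ z : (Fin n → ℝ) × ℝ, (∏ i, gaussianPDF (m + β * τ i ω) (τ i ω) (z.1 i)) *
        gaussianPDF (mt + β * τt ω) (τt ω) z.2 * h z ∂(volume.prod volume) := by
    rintro ω ⟨h1, h2⟩
    have ha : Measurable fun u : Fin n → ℝ => fun i => m + τ i ω * β + √(τ i ω : ℝ) * u i := by
      fun_prop
    have hb : Measurable fun e : ℝ => mt + τt ω * β + √(τt ω : ℝ) * e := by fun_prop
    have hp1 : Measurable fun a : Fin n → ℝ => ∏ i, gaussianPDF (m + β * τ i ω) (τ i ω) (a i) :=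
      Finset.measurable_fun_prod _ fun i _ =>
        (measurable_gaussianPDF _ _).comp (measurable_pi_apply i)
    have e1 : (Measure.pi fun _ : Fin n => gaussianReal 0 1).map
        (fun u i => m + τ i ω * β + √(τ i ω : ℝ) * u i) =
        volume.withDensity fun a => ∏ i, gaussianPDF (m + β * τ i ω) (τ i ω) (a i) := by
      rw [← pi_gaussianReal_eq_withDensity _ h1, Measure.pi_map_pi
        (f := fun i e => m + τ i ω * β + √(τ i ω : ℝ) * e) (fun i => by fun_prop)]
      simp_rw [map_affine_gaussianReal]
    have e2 : (gaussianReal 0 1).map (fun e => mt + τt ω * β + √(τt ω : ℝ) * e) =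
        volume.withDensity (gaussianPDF (mt + β * τt ω) (τt ω)) := by
      rw [map_affine_gaussianReal, gaussianReal_of_var_ne_zero _ h2]
    have hprod : ((Measure.pi fun _ : Fin n => gaussianReal 0 1).prod (gaussianReal 0 1)).map
        (Prod.map (fun u i => m + τ i ω * β + √(τ i ω : ℝ) * u i)
          (fun e => mt + τt ω * β + √(τt ω : ℝ) * e)) =
        (volume.prod volume).withDensity fun z : (Fin n → ℝ) × ℝ =>
          (∏ i, gaussianPDF (m + β * τ i ω) (τ i ω) (z.1 i)) *
            gaussianPDF (mt + β * τt ω) (τt ω) z.2 := by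
      rw [← Measure.map_prod_map _ _ ha hb, e1, e2,
        prod_withDensity hp1 (measurable_gaussianPDF _ _)]
    have hpm : Measurable fun z : (Fin n → ℝ) × ℝ =>
        (∏ i, gaussianPDF (m + β * τ i ω) (τ i ω) (z.1 i)) *
          gaussianPDF (mt + β * τt ω) (τt ω) z.2 :=
      measurable_prod_gaussianPDF_mul (fun _ => measurable_const) measurable_const
        (fun i => (measurable_pi_apply i).comp measurable_fst) measurable_snd
    rw [← lintegral_prod (fun p : (Fin n → ℝ) × ℝ => h (Φ (p.2, (((fun i => τ i ω), τt ω), p.1))))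
      (hh.comp (hΦ.comp
        (measurable_snd.prodMk (measurable_const.prodMk measurable_fst)))).aemeasurable]
    rw [show (fun p : (Fin n → ℝ) × ℝ => h (Φ (p.2, (((fun i => τ i ω), τt ω), p.1)))) =
      fun p => h (Prod.map (fun u i => m + τ i ω * β + √(τ i ω : ℝ) * u i)
          (fun e => mt + τt ω * β + √(τt ω : ℝ) * e) p) from rfl,
      ← lintegral_map hh (ha.prodMap hb), hprod,
      lintegral_withDensity_eq_lintegral_mul _ hpm hh]
    rfl
  rw [lintegral_congr_ae (g := fun ω => ∫⁻ z : (Fin n → ℝ) × ℝ,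
        (∏ i, gaussianPDF (m + β * τ i ω) (τ i ω) (z.1 i)) *
        gaussianPDF (mt + β * τt ω) (τt ω) z.2 * h z ∂(volume.prod volume))
      (hpos.mono fun ω hω => hinner ω hω)]
  have hm : Measurable (Function.uncurry fun ω (z : (Fin n → ℝ) × ℝ) =>
      (∏ i, gaussianPDF (m + β * τ i ω) (τ i ω) (z.1 i)) *
        gaussianPDF (mt + β * τt ω) (τt ω) z.2 * h z) :=
    (measurable_prod_gaussianPDF_mul (fun i => (hτ i).comp measurable_fst)
      (hτt.comp measurable_fst)
      (fun i => (measurable_pi_apply i).comp (measurable_fst.comp measurable_snd))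
      (measurable_snd.comp measurable_snd)).mul (hh.comp measurable_snd)
  rw [lintegral_lintegral_swap hm.aemeasurable]
  refine lintegral_congr fun z => ?_
  rw [Pi.mul_apply, jointDensity]
  exact lintegral_mul_const _ (measurable_prod_gaussianPDF_mul hτ hτt
    (fun _ => measurable_const) measurable_const)

/-- Identifies the denominator of the conditional density as the likelihood. -/
theorem lintegral_jointDensity_snd (hτ : ∀ i, Measurable (τ i)) (hτt : Measurable τt)
    (hτt_pos : ∀ᵐ ω ∂P, 0 < τt ω) (a : Fin n → ℝ) :
    ∫⁻ x, jointDensity P m mt β τ τt (a, x) =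
      ∫⁻ ω, ∏ i, gaussianPDF (m + β * τ i ω) (τ i ω) (a i) ∂P := by
  simp only [jointDensity]
  have hm : Measurable (Function.uncurry fun (x : ℝ) ω =>
      (∏ i, gaussianPDF (m + β * τ i ω) (τ i ω) (a i)) * gaussianPDF (mt + β * τt ω) (τt ω) x) :=
    measurable_prod_gaussianPDF_mul (fun i => (hτ i).comp measurable_snd)
      (hτt.comp measurable_snd) (fun _ => measurable_const) measurable_fst
  rw [lintegral_lintegral_swap hm.aemeasurable]
  refine lintegral_congr_ae (hτt_pos.mono fun ω hω => ?_)
  simp only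
  rw [lintegral_const_mul _ (measurable_gaussianPDF _ _), lintegral_gaussianPDF_eq_one _ hω.ne',
    mul_one]

theorem lintegral_jointDensity_fst (hτ : ∀ i, Measurable (τ i)) (hτt : Measurable τt)
    (hτ_pos : ∀ i, ∀ᵐ ω ∂P, 0 < τ i ω) (x : ℝ) :
    ∫⁻ a, jointDensity P m mt β τ τt (a, x) =
      ∫⁻ ω, gaussianPDF (mt + β * τt ω) (τt ω) x ∂P := by
  simp only [jointDensity]
  have hm : Measurable (Function.uncurry fun (a : Fin n → ℝ) ω =>
      (∏ i, gaussianPDF (m + β * τ i ω) (τ i ω) (a i)) * gaussianPDF (mt + β * τt ω) (τt ω) x) :=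
    measurable_prod_gaussianPDF_mul (fun i => (hτ i).comp measurable_snd)
      (hτt.comp measurable_snd) (fun i => (measurable_pi_apply i).comp measurable_fst)
      measurable_const
  rw [lintegral_lintegral_swap hm.aemeasurable]
  refine lintegral_congr_ae ((ae_all_iff.2 hτ_pos).mono fun ω hω => ?_)
  simp only
  have h1 : ∫⁻ a : Fin n → ℝ, ∏ i, gaussianPDF (m + β * τ i ω) (τ i ω) (a i) = 1 := by
    rw [← setLIntegral_univ, ← withDensity_apply _ MeasurableSet.univ,
      ← pi_gaussianReal_eq_withDensity _ fun i => (hω i).ne', measure_univ]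
  rw [lintegral_mul_const, h1, one_mul]
  exact Finset.measurable_fun_prod _ fun i _ =>
    (measurable_gaussianPDF _ _).comp (measurable_pi_apply i)

end

/-! ### Marginal and conditional densities obtained from a joint density. -/

section

variable {Ω E : Type*} [MeasurableSpace Ω] [MeasurableSpace E] {P : Measure Ω}
  {μE : Measure E} {X : Ω → E} {Y : Ω → ℝ}
  {D : E × ℝ → ℝ≥0∞}

theorem lintegral_eq_one_of_map_eq_withDensity [IsProbabilityMeasure P]
    (hX : AEMeasurable X P) (hY : AEMeasurable Y P)
    (h : P.map (fun ω => (X ω, Y ω)) = (μE.prod volume).withDensity D) :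
    ∫⁻ z, D z ∂(μE.prod volume) = 1 := by
  have := Measure.isProbabilityMeasure_map (hX.prodMk hY)
  rw [← setLIntegral_univ, ← withDensity_apply _ MeasurableSet.univ, ← h, measure_univ]

theorem map_fst_eq_withDensity [SigmaFinite μE]
    (hX : AEMeasurable X P) (hY : AEMeasurable Y P) (hD : Measurable D)
    (h : P.map (fun ω => (X ω, Y ω)) = (μE.prod volume).withDensity D) :
    P.map X = μE.withDensity fun a => ∫⁻ x, D (a, x) := by
  have h1 : P.map X = (P.map (fun ω => (X ω, Y ω))).map Prod.fst := by
    rw [AEMeasurable.map_map_of_aemeasurable measurable_fst.aemeasurable (hX.prodMk hY)]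
    rfl
  refine Measure.ext fun s hs => ?_
  rw [h1, h, Measure.map_apply measurable_fst hs, withDensity_apply _ (measurable_fst hs),
    withDensity_apply _ hs, ← prod_univ, ← Measure.prod_restrict, Measure.restrict_univ,
    lintegral_prod _ hD.aemeasurable]

theorem map_snd_eq_withDensity [IsProbabilityMeasure P] [SigmaFinite μE]
    (hX : AEMeasurable X P) (hY : AEMeasurable Y P) (hD : Measurable D)
    (h : P.map (fun ω => (X ω, Y ω)) = (μE.prod volume).withDensity D) :
    P.map Y = volume.withDensity fun x => (((∫⁻ a, D (a, x) ∂μE).toNNReal : ℝ≥0) : ℝ≥0∞) := by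
  have h1 : P.map Y = (P.map (fun ω => (X ω, Y ω))).map Prod.snd := by
    rw [AEMeasurable.map_map_of_aemeasurable measurable_snd.aemeasurable (hX.prodMk hY)]
    rfl
  have h2 : P.map Y = volume.withDensity fun x => ∫⁻ a, D (a, x) ∂μE := by
    refine Measure.ext fun s hs => ?_
    rw [h1, h, Measure.map_apply measurable_snd hs, withDensity_apply _ (measurable_snd hs),
      withDensity_apply _ hs, ← univ_prod, ← Measure.prod_restrict, Measure.restrict_univ,
      lintegral_prod_symm _ hD.aemeasurable]
  -- The total mass is 1, so the marginal density is finite almost everywhere and `toNNReal` alters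
  -- it only on a null set.
  have hfin : ∫⁻ x, ∫⁻ a, D (a, x) ∂μE ≠ ∞ := by
    rw [← lintegral_prod_symm _ hD.aemeasurable, lintegral_eq_one_of_map_eq_withDensity hX hY h]
    exact ENNReal.one_ne_top
  rw [h2]
  refine withDensity_congr_ae ?_
  filter_upwards [ae_lt_top hD.lintegral_prod_left' hfin] with x hx
  rw [ENNReal.coe_toNNReal hx.ne]

/-- The conditional density attached to a joint density. -/
noncomputable def condDensity (D : E × ℝ → ℝ≥0∞) (a : E) (x : ℝ) : ℝ≥0 :=
  (D (a, x) / ∫⁻ x', D (a, x')).toNNReal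

theorem measurable_condDensity (hD : Measurable D) :
    Measurable (Function.uncurry (condDensity D)) :=
  (hD.div (hD.lintegral_prod_right'.comp measurable_fst)).ennreal_toNNReal

/-- Disintegrations are almost surely unique, so it suffices that the kernel with density
`condDensity D`, composed with the law of `X`, gives back the joint law. -/
theorem condDistrib_ae_eq_withDensity [IsProbabilityMeasure P] [SigmaFinite μE]
    (hX : AEMeasurable X P) (hY : AEMeasurable Y P)
    (hD : Measurable D) (h : P.map (fun ω => (X ω, Y ω)) = (μE.prod volume).withDensity D) :
    ∀ᵐ a ∂(P.map X), condDistrib Y X P a =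
      volume.withDensity (fun x => (condDensity D a x : ℝ≥0∞)) := by
  have hp : Measurable (Function.uncurry fun a x => (condDensity D a x : ℝ≥0∞)) :=
    (measurable_condDensity hD).coe_nnreal_ennreal
  let κ : Kernel E ℝ := Kernel.withDensity (Kernel.const E volume)
    (fun a x => (condDensity D a x : ℝ≥0∞))
  have hκ : ∀ a, κ a = volume.withDensity (fun x => (condDensity D a x : ℝ≥0∞)) := by
    intro a
    rw [Kernel.withDensity_apply _ hp, Kernel.const_apply]
  have hDa : ∀ a, Measurable fun x => D (a, x) := fun a => hD.comp measurable_prodMk_left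
  have hfinκ : IsFiniteKernel κ := by
    -- Mass at most 1 is all that holds for every `a`: where the first marginal density is 0 or `∞`,
    -- the quotient need not be a probability density.
    refine ⟨1, ENNReal.one_lt_top, fun a => ?_⟩
    rw [hκ, withDensity_apply _ MeasurableSet.univ, setLIntegral_univ]
    calc ∫⁻ x, (condDensity D a x : ℝ≥0∞) ≤ ∫⁻ x, D (a, x) / ∫⁻ x', D (a, x') :=
          lintegral_mono fun x => ENNReal.coe_toNNReal_le_self
      _ = (∫⁻ x, D (a, x)) / ∫⁻ x', D (a, x') := by
          simp_rw [div_eq_mul_inv]; rw [lintegral_mul_const _ (hDa a)]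
      _ ≤ 1 := ENNReal.div_self_le_one
  have hone := lintegral_eq_one_of_map_eq_withDensity hX hY h
  have hℓm : Measurable fun a => ∫⁻ x, D (a, x) := hD.lintegral_prod_right'
  have hℓ : ∀ᵐ a ∂μE, ∫⁻ x, D (a, x) < ∞ := by
    refine ae_lt_top hℓm ?_
    rw [← lintegral_prod _ hD.aemeasurable, hone]
    exact ENNReal.one_ne_top
  have hkey : P.map (fun ω => (X ω, Y ω)) = P.map X ⊗ₘ κ := by
    have : IsProbabilityMeasure (P.map X) := Measure.isProbabilityMeasure_map hX
    refine Measure.ext_of_lintegral _ fun g hg => ?_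
    have hga : ∀ a, Measurable fun x => g (a, x) := fun a => hg.comp measurable_prodMk_left
    rw [Measure.lintegral_compProd hg, map_fst_eq_withDensity hX hY hD h, h,
      lintegral_withDensity_eq_lintegral_mul _ hD hg,
      lintegral_withDensity_eq_lintegral_mul _ hℓm hg.lintegral_kernel_prod_right',
      lintegral_prod _ (hD.mul hg).aemeasurable]
    refine lintegral_congr_ae ?_
    filter_upwards [hℓ] with a ha
    simp only [Pi.mul_apply]
    have hpa : Measurable fun x => (condDensity D a x : ℝ≥0∞) := hp.comp measurable_prodMk_left
    rw [hκ, lintegral_withDensity_eq_lintegral_mul _ hpa (hga a),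
      ← lintegral_const_mul _ (hpa.mul (hga a))]
    refine lintegral_congr_ae ?_
    -- Multiplying the quotient back by the marginal must recover `D` even where the marginal
    -- vanishes.
    have hD0 : ∀ᵐ x, (∫⁻ x, D (a, x)) = 0 → D (a, x) = 0 := by
      by_cases h0 : ∫⁻ x, D (a, x) = 0
      · filter_upwards [(lintegral_eq_zero_iff (hDa a)).1 h0] with x hx _ using hx
      · exact ae_of_all _ fun x hx => absurd hx h0
    filter_upwards [ae_lt_top (hDa a) ha.ne, hD0] with x hx hx0
    simp only [Pi.mul_apply]
    rw [← mul_assoc]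
    congr 1
    by_cases h0 : ∫⁻ x, D (a, x) = 0
    · rw [h0, hx0 h0, zero_mul]
    · rw [condDensity, ENNReal.coe_toNNReal (ENNReal.div_ne_top hx.ne h0),
        ENNReal.mul_div_cancel h0 ha.ne]
  filter_upwards [condDistrib_ae_eq_of_measure_eq_compProd X hY hkey] with a ha
  rw [ha, hκ]

end

/-! ### Laplace transforms of the weighted functionals, and the two density formulas. -/

theorem HasHalfLineIntegral.mul_const {g : ℝ → ℝ} {I : ℝ} (h : HasHalfLineIntegral g I) (c : ℝ) :
    HasHalfLineIntegral (fun y => g y * c) (I * c) :=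
  ⟨fun T => (h.1 T).mul_const c, (h.2.mul_const c).congr fun _ => (integral_mul_const _ _).symm⟩

theorem HasOrthantIntegral.const_mul {n : ℕ} {g : (Fin n → ℝ) → ℝ} {I : ℝ}
    (h : HasOrthantIntegral g I) (c : ℝ) : HasOrthantIntegral (fun y => c * g y) (c * I) :=
  ⟨fun T => (h.1 T).const_mul c, (h.2.const_mul c).congr fun _ => (integral_const_mul _ _).symm⟩

theorem weightedSum_nonneg {V : Type*} {n : ℕ} (β : ℝ) {f : Fin n → V → ℝ}
    (hf : ∀ i x, 0 ≤ f i x) (ys : Fin n → ℝ) (x : V) : 0 ≤ weightedSum β f ys x :=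
  Finset.sum_nonneg fun i _ => mul_nonneg (weight_nonneg _ _) (hf i x)

theorem measurable_weightedSum {V : Type*} [MeasurableSpace V] {n : ℕ} (β : ℝ) {f : Fin n → V → ℝ}
    (hf : ∀ i, Measurable (f i)) (ys : Fin n → ℝ) : Measurable (weightedSum β f ys) :=
  Finset.measurable_fun_sum _ fun i _ => (hf i).const_mul _

section

variable {Ω V : Type*} [MeasurableSpace Ω] [MeasurableSpace V] {P : Measure Ω}
  [IsProbabilityMeasure P] {ν : Measure V} [SigmaFinite ν] {N : Ω → Measure V} {n : ℕ}
  {f : Fin n → V → ℝ} {ft : V → ℝ}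

theorem ae_lintegral_weight_mul (hN : IsPoissonRandomMeasure N ν P) (β y : ℝ)
    (hft_meas : Measurable ft) (hft_nonneg : ∀ x, 0 ≤ ft x) (hft_fin : laplaceExponent ν ft ≠ ∞) :
    ∀ᵐ ω ∂P, ∫⁻ x, ENNReal.ofReal (weight β y * ft x) ∂(N ω) =
      ENNReal.ofReal (weight β y * linearFunctional N ft ω) := by
  filter_upwards [hN.ae_linearFunctional_eq hft_meas hft_nonneg hft_fin] with ω hω
  simp_rw [ENNReal.ofReal_mul (weight_nonneg β y)]
  rw [lintegral_const_mul _ hft_meas.ennreal_ofReal, hω, ENNReal.ofReal_coe_nnreal]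

theorem ae_lintegral_weightedSum (hN : IsPoissonRandomMeasure N ν P) (β : ℝ) (ys : Fin n → ℝ)
    (hf_meas : ∀ i, Measurable (f i)) (hf_nonneg : ∀ i x, 0 ≤ f i x)
    (hf_fin : ∀ i, laplaceExponent ν (f i) ≠ ∞) :
    ∀ᵐ ω ∂P, ∫⁻ x, ENNReal.ofReal (weightedSum β f ys x) ∂(N ω) =
      ENNReal.ofReal (∑ i, weight β (ys i) * linearFunctional N (f i) ω) := by
  have h := ae_all_iff.2 fun i =>
    ae_lintegral_weight_mul hN β (ys i) (hf_meas i) (hf_nonneg i) (hf_fin i)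
  filter_upwards [h] with ω hω
  have h1 : ∀ x, ENNReal.ofReal (weightedSum β f ys x) =
      ∑ i, ENNReal.ofReal (weight β (ys i) * f i x) := fun x =>
    ENNReal.ofReal_sum_of_nonneg fun i _ => mul_nonneg (weight_nonneg _ _) (hf_nonneg i x)
  simp_rw [h1]
  rw [lintegral_finsetSum _ fun i _ => ((hf_meas i).const_mul _).ennreal_ofReal,
    ENNReal.ofReal_sum_of_nonneg fun i _ => mul_nonneg (weight_nonneg _ _) (NNReal.coe_nonneg _)]
  exact Finset.sum_congr rfl fun i _ => hω i

theorem exp_neg_laplaceExponent_weight_mul (hN : IsPoissonRandomMeasure N ν P) (β y : ℝ)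
    (hft_meas : Measurable ft) (hft_nonneg : ∀ x, 0 ≤ ft x) (hft_fin : laplaceExponent ν ft ≠ ∞) :
    Real.exp (-(laplaceExponent ν (fun v => weight β y * ft v)).toReal) =
      ∫ ω, Real.exp (-(weight β y * linearFunctional N ft ω)) ∂P :=
  hN.exp_neg_laplaceExponent (hft_meas.const_mul _)
    (fun x => mul_nonneg (weight_nonneg _ _) (hft_nonneg x))
    (fun _ => mul_nonneg (weight_nonneg _ _) (NNReal.coe_nonneg _))
    (ae_lintegral_weight_mul hN β y hft_meas hft_nonneg hft_fin)

/-- `N` is linear, so one Laplace functional covers all the variances jointly, although they are in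
general dependent. -/
theorem exp_neg_laplaceExponent_add_weightedSum (hN : IsPoissonRandomMeasure N ν P) (β y : ℝ)
    (ys : Fin n → ℝ)
    (hf_meas : ∀ i, Measurable (f i)) (hf_nonneg : ∀ i x, 0 ≤ f i x)
    (hf_fin : ∀ i, laplaceExponent ν (f i) ≠ ∞)
    (hft_meas : Measurable ft) (hft_nonneg : ∀ x, 0 ≤ ft x) (hft_fin : laplaceExponent ν ft ≠ ∞) :
    Real.exp (-(laplaceExponent ν (fun v => weight β y * ft v + weightedSum β f ys v)).toReal) =
      ∫ ω, Real.exp (-(weight β y * linearFunctional N ft ω)) *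
        Real.exp (-∑ i, weight β (ys i) * linearFunctional N (f i) ω) ∂P := by
  have h1 : ∀ ω, 0 ≤ weight β y * (linearFunctional N ft ω : ℝ) :=
    fun ω => mul_nonneg (weight_nonneg _ _) (NNReal.coe_nonneg _)
  have h2 : ∀ ω, 0 ≤ ∑ i, weight β (ys i) * (linearFunctional N (f i) ω : ℝ) :=
    fun ω => Finset.sum_nonneg fun i _ => mul_nonneg (weight_nonneg _ _) (NNReal.coe_nonneg _)
  have h3 : ∀ x, 0 ≤ weight β y * ft x := fun x => mul_nonneg (weight_nonneg _ _) (hft_nonneg x)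
  have h4 := weightedSum_nonneg β hf_nonneg ys
  rw [hN.exp_neg_laplaceExponent
    (g := fun v => weight β y * ft v + weightedSum β f ys v)
    (Y := fun ω => weight β y * linearFunctional N ft ω +
      ∑ i, weight β (ys i) * linearFunctional N (f i) ω)
    ((hft_meas.const_mul _).add (measurable_weightedSum β hf_meas ys))
    (fun x => add_nonneg (h3 x) (h4 x)) (fun ω => add_nonneg (h1 ω) (h2 ω))]
  · refine integral_congr_ae (ae_of_all _ fun ω => ?_)
    simp only
    rw [← Real.exp_add]; ring_nf
  · filter_upwards [ae_lintegral_weight_mul hN β y hft_meas hft_nonneg hft_fin,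
      ae_lintegral_weightedSum hN β ys hf_meas hf_nonneg hf_fin] with ω hω1 hω2
    simp_rw [fun x => ENNReal.ofReal_add (h3 x) (h4 x)]
    rw [lintegral_add_left (hft_meas.const_mul _).ennreal_ofReal, hω1, hω2,
      ENNReal.ofReal_add (h1 ω) (h2 ω)]

end

theorem toReal_lintegral_prod_gaussianPDF {Ω : Type*} [MeasurableSpace Ω] {n : ℕ} {P : Measure Ω}
    {μ β Δ : ℝ} {τ : Fin n → Ω → ℝ≥0} (hτ : ∀ i, Measurable (τ i)) (a : Fin n → ℝ) :
    (∫⁻ ω, ∏ i, gaussianPDF (μ * Δ + β * τ i ω) (τ i ω) (a i) ∂P).toReal =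
      likelihood P τ μ β Δ a := by
  have hm : Measurable fun ω => ∏ i, gaussianPDF (μ * Δ + β * τ i ω) (τ i ω) (a i) :=
    Finset.measurable_fun_prod _ fun i _ => measurable_gaussianPDF_comp (hτ i) measurable_const
  rw [likelihood, ← integral_toReal hm.aemeasurable
    (ae_of_all _ fun ω => ENNReal.prod_lt_top fun i _ => gaussianPDF_lt_top)]
  simp_rw [ENNReal.toReal_prod, toReal_gaussianPDF]

/-- Each normal density becomes a cosine transform; the prefactors do not involve the variances and
leave the expectation. -/
theorem toReal_jointDensity {Ω : Type*} [MeasurableSpace Ω] {n : ℕ} {P : Measure Ω}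
    {m mt β : ℝ} {τ : Fin n → Ω → ℝ≥0} {τt : Ω → ℝ≥0} (hτ : ∀ i, Measurable (τ i))
    (hτt : Measurable τt) (a : Fin n → ℝ) (x : ℝ) :
    (jointDensity P m mt β τ τt (a, x)).toReal =
      (∏ i, 1 / Real.pi * Real.exp ((a i - m) * β)) * (1 / Real.pi * Real.exp ((x - mt) * β)) *
        ∫ ω, cosTransformLim β |x - mt| (τt ω) * ∏ i, cosTransformLim β |a i - m| (τ i ω) ∂P := by
  have hm : Measurable fun ω => (∏ i, gaussianPDF (m + β * τ i ω) (τ i ω) (a i)) *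
      gaussianPDF (mt + β * τt ω) (τt ω) x :=
    measurable_prod_gaussianPDF_mul hτ hτt (fun _ => measurable_const) measurable_const
  rw [jointDensity, ← integral_toReal hm.aemeasurable (ae_of_all _ fun ω => ENNReal.mul_lt_top
      (ENNReal.prod_lt_top fun i _ => gaussianPDF_lt_top) gaussianPDF_lt_top),
    ← integral_const_mul]
  refine integral_congr_ae (ae_of_all _ fun ω => ?_)
  simp only [ENNReal.toReal_mul, ENNReal.toReal_prod, toReal_gaussianPDF,
    gaussianPDFReal_eq_cosTransformLim]
  rw [Finset.prod_mul_distrib]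
  ring

theorem toReal_lintegral_gaussianPDF {Ω : Type*} [MeasurableSpace Ω] {P : Measure Ω}
    {m β : ℝ} {τ : Ω → ℝ≥0} (hτ : Measurable τ) (x : ℝ) :
    (∫⁻ ω, gaussianPDF (m + β * τ ω) (τ ω) x ∂P).toReal =
      1 / Real.pi * Real.exp ((x - m) * β) * ∫ ω, cosTransformLim β |x - m| (τ ω) ∂P := by
  rw [← integral_toReal (measurable_gaussianPDF_comp hτ measurable_const).aemeasurable
    (ae_of_all _ fun ω => gaussianPDF_lt_top), ← integral_const_mul]
  refine integral_congr_ae (ae_of_all _ fun ω => ?_)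
  simp only [toReal_gaussianPDF, gaussianPDFReal_eq_cosTransformLim]

theorem proposition2p3
    {Ω V : Type*} [MeasurableSpace Ω] (P : Measure Ω) [IsProbabilityMeasure P]
    [TopologicalSpace V] [PolishSpace V] [MeasurableSpace V] [BorelSpace V]
    (ν : Measure V) [SigmaFinite ν] (N : Ω → Measure V) (hN : IsPoissonRandomMeasure N ν P)
    (n : ℕ) (μ β Δ Δt : ℝ) (hΔ : 0 < Δ) (hΔt : 0 < Δt)
    (f : Fin n → V → ℝ) (ft : V → ℝ)
    (hf_meas : ∀ i, Measurable (f i)) (hf_nonneg : ∀ i x, 0 ≤ f i x)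
    (hft_meas : Measurable ft) (hft_nonneg : ∀ x, 0 ≤ ft x)
    -- finiteness of the integrated volatilities
    (hf_fin : ∀ i, laplaceExponent ν (f i) ≠ ∞) (hft_fin : laplaceExponent ν ft ≠ ∞)
    -- non-degeneracy of the normal variances
    (hτ_pos : ∀ i, ∀ᵐ ω ∂P, 0 < linearFunctional N (f i) ω)
    (hτt_pos : ∀ᵐ ω ∂P, 0 < linearFunctional N ft ω)
    -- standard normal errors, independent of each other and of `N`
    (ε : Fin n → Ω → ℝ) (εt : Ω → ℝ)
    (hε : ∀ i, HasLaw (ε i) (gaussianReal 0 1) P) (hεt : HasLaw εt (gaussianReal 0 1) P)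
    (hε_indep : iIndepFun ε P) (hNε : IndepFun N (fun ω i => ε i ω) P)
    (hεt_indep : IndepFun εt (fun ω => (N ω, fun i => ε i ω)) P)
    -- the data and the new log price
    (X : Ω → Fin n → ℝ) (Xt : Ω → ℝ)
    (hX : X = fun ω i => logPrice (μ * Δ) β (linearFunctional N (f i)) (ε i) ω)
    (hXt : Xt = logPrice (μ * Δt) β (linearFunctional N ft) εt) :
    -- (i) the marginal density
    (∃ p : ℝ → ℝ≥0, Measurable p ∧
      P.map Xt = volume.withDensity (fun x => (p x : ℝ≥0∞)) ∧
      ∀ x : ℝ,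
        (x ≠ μ * Δt ∨ IntegrableOn (fun y : ℝ =>
          Real.exp (-(laplaceExponent ν (fun v => weight β y * ft v)).toReal)) (Ioi 0)) →
        ∃ I : ℝ,
          HasHalfLineIntegral (fun y =>
            Real.exp (-(laplaceExponent ν (fun v => weight β y * ft v)).toReal) *
              Real.cos (y * |x - μ * Δt|)) I ∧
          (p x : ℝ) = 1 / Real.pi * Real.exp ((x - μ * Δt) * β) * I) ∧
    -- (ii) the posterior (predictive) density given the data
    (∃ p : (Fin n → ℝ) → ℝ → ℝ≥0, Measurable (Function.uncurry p) ∧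
      (∀ᵐ a ∂(P.map X), condDistrib Xt X P a = volume.withDensity (fun x => (p a x : ℝ≥0∞))) ∧
      ∀ a : Fin n → ℝ, (∀ i, a i ≠ μ * Δ) → ∀ x : ℝ,
        (x ≠ μ * Δt ∨ IntegrableOn (fun y : ℝ =>
          Real.exp (-(laplaceExponent ν (fun v => weight β y * ft v)).toReal)) (Ioi 0)) →
        ∃ (J : (Fin n → ℝ) → ℝ) (I : ℝ),
          (∀ ys : Fin n → ℝ, HasHalfLineIntegral (fun y =>
            Real.exp (-((laplaceExponent ν
                (fun v => weight β y * ft v + weightedSum β f ys v)).toReal -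
                (laplaceExponent ν (weightedSum β f ys)).toReal)) *
              Real.cos (y * |x - μ * Δt|)) (J ys)) ∧
          HasOrthantIntegral (fun ys => J ys * mixingDensity P N ν f μ β Δ a ys) I ∧
          (p a x : ℝ) = 1 / Real.pi * Real.exp ((x - μ * Δt) * β) * I) := by
  have hτm : ∀ i, Measurable (linearFunctional N (f i)) := fun i =>
    hN.measurable_linearFunctional (hf_meas i)
  have hτtm : Measurable (linearFunctional N ft) := hN.measurable_linearFunctional hft_meas
  have hτtR : Measurable fun ω => (linearFunctional N ft ω : ℝ) := hτtm.coe_nnreal_real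
  have hτt_pos' : ∀ᵐ ω ∂P, 0 < (linearFunctional N ft ω : ℝ) := hτt_pos
  -- All variances are one measurable function of `N`, so independence from `N` passes to them.
  let T : Measure V → (Fin n → ℝ≥0) × ℝ≥0 := fun M =>
    (fun i => (∫⁻ x, ENNReal.ofReal (f i x) ∂M).toNNReal, (∫⁻ x, ENNReal.ofReal (ft x) ∂M).toNNReal)
  have hT : Measurable T :=
    (measurable_pi_lambda _ fun i =>
      (Measure.measurable_lintegral (hf_meas i).ennreal_ofReal).ennreal_toNNReal).prodMk
      (Measure.measurable_lintegral hft_meas.ennreal_ofReal).ennreal_toNNReal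
  have hlaw := map_logPrice_eq_withDensity (m := μ * Δ) (mt := μ * Δt) (β := β) hτm hτtm
    hτ_pos hτt_pos hε hεt hε_indep (hNε.comp hT measurable_id)
    (hεt_indep.comp measurable_id (hT.prodMap measurable_id))
  have hD := measurable_jointDensity (P := P) (m := μ * Δ) (mt := μ * Δt) (β := β) hτm hτtm
  have hXm : AEMeasurable X P := by
    rw [hX]
    refine aemeasurable_pi_lambda _ fun i => ?_
    have h1 := (hε i).aemeasurable
    have h2 := (hτm i).coe_nnreal_real.aemeasurable (μ := P)
    unfold logPrice
    fun_prop
  have hXtm : AEMeasurable Xt P := by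
    rw [hXt]
    have h1 := hεt.aemeasurable
    have h2 := hτtR.aemeasurable (μ := P)
    unfold logPrice
    fun_prop
  have hjoint : P.map (fun ω => (X ω, Xt ω)) = (volume.prod volume).withDensity
      (jointDensity P (μ * Δ) (μ * Δt) β (fun i => linearFunctional N (f i))
        (linearFunctional N ft)) := by
    rw [← hlaw, hX, hXt]
  have hbound : ∀ x : ℝ, (x ≠ μ * Δt ∨ IntegrableOn (fun y : ℝ =>
          Real.exp (-(laplaceExponent ν (fun v => weight β y * ft v)).toReal)) (Ioi 0)) →
      ∃ B : Ω → ℝ, Integrable B P ∧ ∀ᵐ ω ∂P, ∀ T,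
        |cosTransform β |x - μ * Δt| T (linearFunctional N ft ω)| ≤ B ω := by
    intro x hx
    refine exists_bound_cosTransform hτtR hτt_pos' (hx.imp ?_ ?_)
    · exact fun h => abs_ne_zero.2 (sub_ne_zero.2 h)
    · intro h
      simpa only [exp_neg_laplaceExponent_weight_mul hN β _ hft_meas hft_nonneg hft_fin] using h
  -- The densities are the second marginal of the joint density and its quotient by the first; only
  -- their pointwise evaluation remains.
  refine ⟨⟨_, ?_, map_snd_eq_withDensity hXm hXtm hD hjoint, fun x hx => ?_⟩,
    ⟨_, measurable_condDensity hD, condDistrib_ae_eq_withDensity hXm hXtm hD hjoint,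
      fun a ha x hx => ?_⟩⟩
  · exact hD.lintegral_prod_left'.ennreal_toNNReal
  · obtain ⟨B, hB, hSB⟩ := hbound x hx
    refine ⟨∫ ω, cosTransformLim β |x - μ * Δt| (linearFunctional N ft ω) ∂P, ?_, ?_⟩
    · have h := hasHalfLineIntegral_integral hτtR hτt_pos' (G := fun _ => 1) measurable_const
        (by simp) hB hSB
      simp only [mul_one] at h
      simpa only [exp_neg_laplaceExponent_weight_mul hN β _ hft_meas hft_nonneg hft_fin] using h
    · rw [lintegral_jointDensity_fst hτm hτtm hτ_pos, ← toReal_lintegral_gaussianPDF hτtm]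
      rfl
  · obtain ⟨B, hB, hSB⟩ := hbound x hx
    set τt : Ω → ℝ := fun ω => linearFunctional N ft ω with hτt
    set τ : Fin n → Ω → ℝ := fun i ω => linearFunctional N (f i) ω with hτ
    have hτR : ∀ i, Measurable (τ i) := fun i => (hτm i).coe_nnreal_real
    set G : (Fin n → ℝ) → Ω → ℝ := fun ys ω => Real.exp (-∑ i, weight β (ys i) * τ i ω) with hG
    have hGm : ∀ ys, Measurable (G ys) := fun ys =>
      (Finset.measurable_fun_sum _ fun i _ => (hτR i).const_mul _).neg.exp
    have hG1 : ∀ ys ω, |G ys ω| ≤ 1 := by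
      intro ys ω
      rw [Real.abs_exp]
      exact Real.exp_le_one_iff.2 (neg_nonpos.2 (Finset.sum_nonneg fun i _ =>
        mul_nonneg (weight_nonneg _ _) (NNReal.coe_nonneg _)))
    set E : (Fin n → ℝ) → ℝ := fun ys =>
      Real.exp (laplaceExponent ν (weightedSum β f ys)).toReal with hE
    set H : Ω → ℝ := fun ω => cosTransformLim β |x - μ * Δt| (τt ω) with hH
    have hHint : Integrable H P := integrable_cosTransformLim hτtR hτt_pos' hB hSB
    have hexp : ∀ r s : ℝ, Real.exp (-(r - s)) = Real.exp (-r) * Real.exp s := fun r s => by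
      rw [← Real.exp_add]; ring_nf
    have hc : ∀ i, |a i - μ * Δ| ≠ 0 := fun i => abs_ne_zero.2 (sub_ne_zero.2 (ha i))
    have hO := (hasOrthantIntegral_integral (β := β) hc hτR hτ_pos hHint).const_mul
      ((Real.pi ^ n)⁻¹ * Real.exp ((∑ i, (a i - μ * Δ)) * β) /
        likelihood P (fun i => linearFunctional N (f i)) μ β Δ a)
    -- The inner integral is `E[H G]` times `e^{Λ(Ω_n)}`; the last factor cancels against the mixing
    -- density.
    refine ⟨fun ys => (∫ ω, H ω * G ys ω ∂P) * E ys,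
      (Real.pi ^ n)⁻¹ * Real.exp ((∑ i, (a i - μ * Δ)) * β) /
        likelihood P (fun i => linearFunctional N (f i)) μ β Δ a *
        ∫ ω, H ω * ∏ i, cosTransformLim β |a i - μ * Δ| (τ i ω) ∂P, fun ys => ?_, ?_, ?_⟩
    · have h := (hasHalfLineIntegral_integral hτtR hτt_pos' (hGm ys) (hG1 ys) hB hSB).mul_const
        (E ys)
      refine (congrArg (HasHalfLineIntegral · _) (funext fun y => ?_)).mp h
      rw [hexp, exp_neg_laplaceExponent_add_weightedSum hN β y ys
        hf_meas hf_nonneg hf_fin hft_meas hft_nonneg hft_fin]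
      ring
    · refine (congrArg (HasOrthantIntegral · _) (funext fun ys => ?_)).mp hO
      have h1 : ∀ ω, H ω * ∏ i, (Real.exp (-(weight β (ys i) * τ i ω)) *
          Real.cos (ys i * |a i - μ * Δ|)) =
          (∏ i, Real.cos (ys i * |a i - μ * Δ|)) * (H ω * G ys ω) := by
        intro ω
        simp only [hG]
        rw [Finset.prod_mul_distrib, ← Real.exp_sum, Finset.sum_neg_distrib]
        ring
      simp_rw [h1]
      rw [integral_const_mul, mixingDensity, hexp]
      have h2 : E ys * Real.exp (-(laplaceExponent ν (weightedSum β f ys)).toReal) = 1 := by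
        rw [hE, ← Real.exp_add]; simp
      linear_combination (-(∫ ω, H ω * G ys ω ∂P) * (Real.pi ^ n)⁻¹ *
        Real.exp ((∑ i, (a i - μ * Δ)) * β) * (∏ i, Real.cos (ys i * |a i - μ * Δ|)) /
        likelihood P (fun i => linearFunctional N (f i)) μ β Δ a) * h2
    -- `toReal` commutes with division unconditionally, so the likelihood need not be shown positive
    -- here.
    · rw [condDensity, lintegral_jointDensity_snd hτm hτtm hτt_pos, ENNReal.coe_toNNReal_eq_toReal,
        ENNReal.toReal_div, toReal_lintegral_prod_gaussianPDF hτm, toReal_jointDensity hτm hτtm,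
        Finset.prod_mul_distrib, Finset.prod_const, Finset.card_univ, Fintype.card_fin,
        ← Real.exp_sum, ← Finset.sum_mul, one_div, inv_pow]
      ring
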